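/- \textbf{Model.} A group of $N$ voters, $N\ge 3$ odd, consists of one expert ($K=1$) and $M=N-1$ non-experts. The state $\omega\in\{\omega_1,\omega_2\}$ has prior $\pi=\Pr(\omega_1)=1/2$; the group takes a decision $d\in\{d_1,d_2\}$, and every voter's payoff is $1$ if the decision matches the state and $0$ otherwise. Given the state, voters receive independent signals in $\{\sigma_1,\sigma_2\}$; the signal of voter $i$ is correct with probability $q_i$ (her precision) in either state. The expert's precision is commonly known to be $p\in(1/2,1)$. The precisions of the non-experts are private information, drawn independently from a distribution with continuous distribution function $F$ and support $[1/2,p]$. Each voter, knowing her precision and her signal, votes for a decision, or delegates her vote to a category (experts or non-experts), in which case it goes to a uniformly random other member of that category. Delegation is multi-step: a voter who delegates passes on all the votes she has received. If delegations form a circular flow, one of its links is chosen at random and all the votes of the flow go to a random voter, outside the flow, of the category selected by that link (a link whose category has no voter outside the flow is not chosen; if there is no admissible link, the votes of the flow are not cast). The decision with more votes is chosen; a coin is tossed if there is none, in particular if all $N$ voters are in one circular flow. A profile of (possibly mixed) strategies is \emph{semi-symmetric} if voters of the same category use the same strategy and strategies are symmetric across the two signals, and \emph{sincere} if nobody ever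 votes against her signal. \emph{Equilibrium} means a semi-symmetric sincere perfect Bayesian equilibrium in strategies that are not weakly dominated: for each voter, each precision and each signal, every action used is optimal among all actions available to her. Let $EU$ denote the ex ante probability of a correct decision. \textbf{Proposition.} There is a threshold $\widetilde q\in(1/2,p)$ such that the following profile is an equilibrium: the expert never delegates and always votes according to her signal; each non-expert $i$ delegates to the expert if $q_i<\widetilde q$, and votes according to her signal otherwise. The value of $EU$ in this equilibrium is strictly higher than under majority voting in which everybody votes according to her signal, and it is the maximum of $EU$ over all sincere semi-symmetric profiles in which the expert never delegates and non-experts never delegate to non-experts (so in particular over all such equilibria). -/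

import Mathlib

open MeasureTheory ProbabilityTheory

namespace LiquidDemocracy

/-- What a voter can do: cast her vote for one of the two decisions, or delegate it to a random
voter of one of the two categories. States, decisions and signals are all encoded by `Bool`;
the decision `d` is correct in the state `ω` when `d = ω`, and the signal `s` recommends `s`. -/
inductive Action
  | vote (d : Bool)
  | toExpert
  | toNonExpert
  deriving DecidableEq, Fintype

/-- The action with the names of the two decisions exchanged. -/
def Action.flip : Action → Action
  | .vote d => .vote (!d)
  | .toExpert => .toExpert
  | .toNonExpert => .toNonExpert

/-- The data of the voting problem: `N` voters, some of them experts, the prior probability of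
the state `true`, the precision `p` of every expert, and the law `F` from which the precisions of
the non-experts are drawn independently. -/
structure Environment (N : ℕ) where
  experts : Finset (Fin N)
  prior : ℝ
  p : ℝ
  F : Measure ℝ

/-! ### Counting the votes: delegation flows and their resolution -/

section Delegation

variable {N : ℕ}

/-- The mean of `f` over the finite set `s`. -/
noncomputable def mean {α : Type*} (s : Finset α) (f : α → ℝ) : ℝ :=
  (∑ x ∈ s, f x) / s.card

/-- The category of voters to which an action delegates (empty for a vote). -/
def category (E : Finset (Fin N)) : Action → Finset (Fin N)
  | .vote _ => ∅
  | .toExpert => E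
  | .toNonExpert => Eᶜ

/-- The voters to whom the vote of `i` may go in the first place under an action: herself if she
votes, and any *other* voter of the selected category if she delegates. -/
def targets (E : Finset (Fin N)) (i : Fin N) : Action → Finset (Fin N)
  | .vote _ => {i}
  | .toExpert => E.erase i
  | .toNonExpert => Eᶜ.erase i

/-- An action is available to `i` if there is somebody to carry it out. -/
def Feasible (E : Finset (Fin N)) (i : Fin N) (a : Action) : Prop :=
  (targets E i a).Nonempty

/-- A delegation map `g` sends each voter to the voter she hands her packet of votes to; a voter
who casts her packet is a fixed point. The votes of `v` run in a circle if they never get to a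
voter who casts them. -/
def Circular (g : Fin N → Fin N) (v : Fin N) : Prop :=
  ∀ n : ℕ, g (g^[n] v) ≠ g^[n] v

open Classical in
/-- The flow of `v`: all voters whose votes come together with those of `v`. If the votes of `v`
run in a circle, it is the circle with all voters who delegate into it, directly or not. -/
noncomputable def flow (g : Fin N → Fin N) (v : Fin N) : Finset (Fin N) :=
  Finset.univ.filter fun w => ∃ m n : ℕ, g^[m] w = g^[n] v

/-- All the votes of the flow `C` are handed to `t`. -/
def redirect (g : Fin N → Fin N) (C : Finset (Fin N)) (t : Fin N) : Fin N → Fin N :=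
  fun v => if v ∈ C then t else g v

open Classical in
/-- The voters in circular flows whose delegation can be redirected: somebody in the selected
category is outside the flow. -/
noncomputable def redirectable (cat : Fin N → Finset (Fin N)) (g : Fin N → Fin N) :
    Finset (Fin N) :=
  Finset.univ.filter fun u => Circular g u ∧ (cat u \ flow g u).Nonempty

open Classical in
/-- The expected value of `val` at the delegation map that results from `g` when circular flows
are broken up, in at most `n` rounds. In a round, a link of a circular flow is chosen at random
among those that can be redirected, and the votes of that flow all go to a random voter,
outside the flow, in the category selected by that link. -/
noncomputable def resolve (cat : Fin N → Finset (Fin N)) (val : (Fin N → Fin N) → ℝ) :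
    ℕ → (Fin N → Fin N) → ℝ
  | 0, g => val g
  | n + 1, g =>
      if (redirectable cat g).Nonempty then
        mean (redirectable cat g) fun u =>
          mean (cat u \ flow g u) fun t => resolve cat val n (redirect g (flow g u) t)
      else val g

open Classical in
/-- The number of votes cast for `d` when packets move along `g` and the actions are `a`. -/
noncomputable def tally (a : Fin N → Action) (g : Fin N → Fin N) (d : Bool) : ℕ :=
  (Finset.univ.filter fun v => ∃ n : ℕ, g (g^[n] v) = g^[n] v ∧ a (g^[n] v) = .vote d).card

/-- The probability that the decision is correct in the state `ω` when packets move along `g`: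
the decision with more votes is chosen, and a coin is tossed if there is none (as when all voters
are in one circular flow and no vote is cast). -/
noncomputable def majorityCorrect (a : Fin N → Action) (ω : Bool) (g : Fin N → Fin N) : ℝ :=
  if tally a g (!ω) < tally a g ω then 1
  else if tally a g ω < tally a g (!ω) then 0
  else 1 / 2

/-- The probability that the group takes the correct decision in the state `ω` when the actions
are `a`. Delegated votes are first assigned independently and uniformly; then circular flows are
broken up. Each round lowers the number of circular flows, so `N` rounds are enough. -/
noncomputable def correctProb (E : Finset (Fin N)) (a : Fin N → Action) (ω : Bool) : ℝ :=
  mean (Fintype.piFinset fun i => targets E i (a i)) fun g =>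
    resolve (fun i => category E (a i)) (majorityCorrect a ω) N g

end Delegation

/-! ### The game -/

/-- A behavioural strategy: `τ q s a` is the probability of the action `a` for a voter whose
signal is `s` and has precision `q`. -/
abbrev Strategy := ℝ → Bool → Action → ℝ

/-- A strategy for each voter. -/
abbrev Profile (N : ℕ) := Fin N → Strategy

/-- The lottery that puts probability one on the action `b`. -/
def play (b : Action) : Action → ℝ := fun a => if a = b then 1 else 0

/-- The probability of the signal `s` of precision `q` in the state `ω`. -/
def signalProb (q : ℝ) (s ω : Bool) : ℝ := if s = ω then q else 1 - q

namespace Environment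

variable {N : ℕ} (G : Environment N)

/-- The prior probability of the state `ω`. -/
def stateProb (ω : Bool) : ℝ := if ω then G.prior else 1 - G.prior

/-- The possible precisions of the voter `i`. -/
def precisions (i : Fin N) : Set ℝ := if i ∈ G.experts then {G.p} else Set.Icc (1 / 2) G.p

/-- The law of the precision of the voter `i`. -/
noncomputable def precisionLaw (i : Fin N) : Measure ℝ :=
  if i ∈ G.experts then Measure.dirac G.p else G.F

/-- `τ` is a strategy of the voter `i`. -/
structure IsStrategy (i : Fin N) (τ : Strategy) : Prop where
  measurable : ∀ s a, Measurable fun q => τ q s a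
  nonneg : ∀ q ∈ G.precisions i, ∀ s a, 0 ≤ τ q s a
  sum_eq_one : ∀ q ∈ G.precisions i, ∀ s, ∑ a, τ q s a = 1
  feasible : ∀ q ∈ G.precisions i, ∀ s a, ¬ Feasible G.experts i a → τ q s a = 0

/-- `σ` is a profile of strategies. -/
def IsProfile (σ : Profile N) : Prop := ∀ i, G.IsStrategy i (σ i)

/-- The probability that the voter `i` takes the action `a` in the state `ω`. -/
noncomputable def actionProb (σ : Profile N) (ω : Bool) (i : Fin N) (a : Action) : ℝ :=
  ∫ q, ∑ s, signalProb q s ω * σ i q s a ∂(G.precisionLaw i)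

/-- The probability of the correct decision in the state `ω` when the voters' actions are
independently drawn from the lotteries `ρ i`. -/
noncomputable def correctGiven (ω : Bool) (ρ : Fin N → Action → ℝ) : ℝ :=
  ∑ a : Fin N → Action, (∏ i, ρ i (a i)) * correctProb G.experts a ω

/-- Ex ante expected utility: the probability that the group takes the correct decision.
Given the state, precisions, signals and hence actions are independent across voters. -/
noncomputable def EU (σ : Profile N) : ℝ :=
  ∑ ω, G.stateProb ω * G.correctGiven ω (G.actionProb σ ω)

/-- Interim expected utility: the probability of the correct decision for the voter `i`, by
Bayes' rule, conditional on her signal `s` and its precision `q`, if she takes the action `b`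
and the others follow `σ`. -/
noncomputable def interimEU (σ : Profile N) (i : Fin N) (q : ℝ) (s : Bool) (b : Action) : ℝ :=
  (∑ ω, G.stateProb ω * signalProb q s ω *
      G.correctGiven ω (Function.update (G.actionProb σ ω) i (play b))) /
    ∑ ω, G.stateProb ω * signalProb q s ω

/-- The strategy `τ` of the voter `i` is weakly dominated. -/
def WeaklyDominated (i : Fin N) (τ : Strategy) : Prop :=
  ∃ τ', G.IsStrategy i τ' ∧
    (∀ σ, G.IsProfile σ → G.EU (Function.update σ i τ) ≤ G.EU (Function.update σ i τ')) ∧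
    ∃ σ, G.IsProfile σ ∧ G.EU (Function.update σ i τ) < G.EU (Function.update σ i τ')

/-- Voters of the same category follow the same strategy, and strategies are symmetric across
signals. -/
def SemiSymmetric (σ : Profile N) : Prop :=
  (∀ i j, (i ∈ G.experts ↔ j ∈ G.experts) → ∀ q ∈ G.precisions i, σ i q = σ j q) ∧
    ∀ i, ∀ q ∈ G.precisions i, ∀ s a, σ i q (!s) a.flip = σ i q s a

/-- Nobody votes against her signal. -/
def Sincere (σ : Profile N) : Prop :=
  ∀ i, ∀ q ∈ G.precisions i, ∀ s, σ i q s (.vote (!s)) = 0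

/-- Experts never delegate, and non-experts delegate to experts only. -/
def OnlyToExperts (σ : Profile N) : Prop :=
  (∀ i ∈ G.experts, ∀ q ∈ G.precisions i, ∀ s,
      σ i q s .toExpert = 0 ∧ σ i q s .toNonExpert = 0) ∧
    ∀ i ∉ G.experts, ∀ q ∈ G.precisions i, ∀ s, σ i q s .toNonExpert = 0

/-- Semi-symmetric perfect Bayesian equilibria in undominated strategies with sincere voting:
every action in use is optimal for every type of every voter, against every action available
to that voter. -/
structure IsEquilibrium (σ : Profile N) : Prop where
  isProfile : G.IsProfile σ
  semiSymmetric : G.SemiSymmetric σ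
  sincere : G.Sincere σ
  optimal : ∀ i, ∀ q ∈ G.precisions i, ∀ s a, 0 < σ i q s a →
    ∀ b, Feasible G.experts i b → G.interimEU σ i q s b ≤ G.interimEU σ i q s a
  undominated : ∀ i, ¬ G.WeaklyDominated i (σ i)

/-- Sincere majority voting: everybody votes her signal. -/
def majorityVoting : Profile N := fun _ _ s => play (.vote s)

/-- Experts vote their signals; non-experts delegate to an expert if their precision is below
`t`, and vote their signals otherwise. -/
noncomputable def thresholdProfile (t : ℝ) : Profile N := fun i q s =>
  if i ∉ G.experts ∧ q < t then play .toExpert else play (.vote s)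

end Environment

end LiquidDemocracy

/-!
Let there be `2 * k + 3` voters. If the expert votes and each non-expert votes or delegates to her,
the decision is wrong in spite of a correct vote of the expert exactly if more than `k + 1`
non-experts vote for the wrong decision, and right in spite of a wrong vote of hers exactly if more
than `k + 1` of them vote for the correct one. So utility depends only on the probabilities `c` and
`w` that a non-expert casts a correct or a wrong vote (`EU_eq_groupWinProb`). For a given turnout
`c + w` it is best to let the best informed vote (`IsVotingRule.exists_thresholdRule`), so by
compactness some threshold `t` is optimal among all ways to vote or delegate to the expert.

Since the game is one of common interest, the first-order condition of this problem says that no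
single non-expert gains by a different choice between her vote and delegation to the expert
(`IsVotingRule.first_order`). In terms of the probabilities `distortionProb` and `correctionProb`
that a further vote is pivotal and the expert is right, respectively wrong, it says that an
interior `t` is the probability that the expert is right, given that a further vote is pivotal. The
optimum is interior (`exists_interior_optimum`). With threshold `1 / 2` everybody votes, the expert
is then right with probability more than one half in the pivotal event, and the least informed had
better delegate; this is also why the optimum beats majority voting. With threshold `p` nobody but
the expert votes, and votes by non-experts whose odds of being right exceed the square root of
those of the expert are an improvement, because two more of them must vote against her than with
her to overrule her.

There remain the other deviations. In the pivotal event for a non-expert, `k + 1` of the other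
`2 * k + 1` non-experts vote against the expert, so that delegation to a random one of them is worse
than delegation to the expert as soon as the latter is right with probability more than one half,
and `1 / 2 < t` says just this (`trinomialMean_nonExpert_delegates`). If the expert delegates, all
delegated votes go to a random voter among the non-experts, directly or after a circular flow has
been broken up (`correctProb_of_expert_delegates`). Such a voter is less well informed than she is,
and no better informed in the cases in which these votes are pivotal
(`trinomialMean_expert_delegates_lt`). Finally, best responses are unique except at the threshold,
a null set, so no strategy of the profile is weakly dominated (`not_weaklyDominated`).

The computations use the mean `trinomialMean` over the numbers of correct and wrong votes, which is
defined by recursion on the number of voters; exchangeability of the voters, the change of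
measure between different `c` and `w`, and the derivative all follow by induction.
-/

namespace LiquidDemocracy

/-! ### Means over independent three-way trials -/

/-- The mean of `f x y`, where `x` and `y` count the outcomes of the first and of the second kind
in `n` independent trials with three outcomes of weights `c`, `w` and `d`. The weights need not
add up to one. -/
noncomputable def trinomialMean (c w d : ℝ) : ℕ → (ℕ → ℕ → ℝ) → ℝ
  | 0, f => f 0 0
  | n + 1, f => c * trinomialMean c w d n (fun x y => f (x + 1) y) +
      w * trinomialMean c w d n (fun x y => f x (y + 1)) + d * trinomialMean c w d n f

section Trinomial

variable {c w d : ℝ}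

theorem trinomialMean_add (n : ℕ) (f g : ℕ → ℕ → ℝ) :
    trinomialMean c w d n (fun x y => f x y + g x y) =
      trinomialMean c w d n f + trinomialMean c w d n g := by
  induction n generalizing f g with
  | zero => rfl
  | succ n ih => simp only [trinomialMean, ih]; ring

theorem trinomialMean_mul_left (n : ℕ) (r : ℝ) (f : ℕ → ℕ → ℝ) :
    trinomialMean c w d n (fun x y => r * f x y) = r * trinomialMean c w d n f := by
  induction n generalizing f with
  | zero => rfl
  | succ n ih => simp only [trinomialMean, ih]; ring

theorem trinomialMean_sub (n : ℕ) (f g : ℕ → ℕ → ℝ) :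
    trinomialMean c w d n (fun x y => f x y - g x y) =
      trinomialMean c w d n f - trinomialMean c w d n g := by
  induction n generalizing f g with
  | zero => rfl
  | succ n ih => simp only [trinomialMean, ih]; ring

theorem trinomialMean_const (h : c + w + d = 1) (n : ℕ) (r : ℝ) :
    trinomialMean c w d n (fun _ _ => r) = r := by
  induction n with
  | zero => rfl
  | succ n ih => simp only [trinomialMean, ih]; linear_combination r * h

/-- Only counts that can occur matter: their sum is at most `n`, and exactly `n` if the third
outcome has weight zero. -/
theorem trinomialMean_mono (hc : 0 ≤ c) (hw : 0 ≤ w) (hd : 0 ≤ d) {n : ℕ} {f g : ℕ → ℕ → ℝ}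
    (h : ∀ x y, x + y ≤ n → (d = 0 → x + y = n) → f x y ≤ g x y) :
    trinomialMean c w d n f ≤ trinomialMean c w d n g := by
  induction n generalizing f g with
  | zero => exact h 0 0 le_rfl fun _ => rfl
  | succ n ih =>
    simp only [trinomialMean]
    refine add_le_add (add_le_add (mul_le_mul_of_nonneg_left (ih fun x y hxy h0 => ?_) hc)
      (mul_le_mul_of_nonneg_left (ih fun x y hxy h0 => ?_) hw)) ?_
    · exact h _ _ (by omega) fun h1 => by have := h0 h1; omega
    · exact h _ _ (by omega) fun h1 => by have := h0 h1; omega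
    · rcases hd.eq_or_lt with rfl | hd'
      · simp
      · exact mul_le_mul_of_nonneg_left
          (ih fun x y hxy _ => h _ _ (by omega) fun h1 => absurd h1 hd'.ne') hd

theorem trinomialMean_congr (hc : 0 ≤ c) (hw : 0 ≤ w) (hd : 0 ≤ d) {n : ℕ} {f g : ℕ → ℕ → ℝ}
    (h : ∀ x y, x + y ≤ n → f x y = g x y) :
    trinomialMean c w d n f = trinomialMean c w d n g :=
  le_antisymm (trinomialMean_mono hc hw hd fun x y hxy _ => (h x y hxy).le)
    (trinomialMean_mono hc hw hd fun x y hxy _ => (h x y hxy).ge)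

theorem trinomialMean_nonneg (hc : 0 ≤ c) (hw : 0 ≤ w) (hd : 0 ≤ d) {n : ℕ} {f : ℕ → ℕ → ℝ}
    (h : ∀ x y, x + y ≤ n → (d = 0 → x + y = n) → 0 ≤ f x y) :
    0 ≤ trinomialMean c w d n f := by
  have h0 : trinomialMean c w d n (fun _ _ => 0) = 0 := by
    simpa using trinomialMean_mul_left (c := c) (w := w) (d := d) n 0 (fun _ _ => 0)
  rw [← h0]
  exact trinomialMean_mono hc hw hd h

theorem le_trinomialMean (hc : 0 ≤ c) (hw : 0 ≤ w) (hd : 0 ≤ d) {f : ℕ → ℕ → ℝ}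
    (hf : ∀ x y, 0 ≤ f x y) (a b e : ℕ) :
    c ^ a * w ^ b * d ^ e * f a b ≤ trinomialMean c w d (a + b + e) f := by
  have key (n : ℕ) {g : ℕ → ℕ → ℝ} (hg : ∀ x y, 0 ≤ g x y) : 0 ≤ trinomialMean c w d n g :=
    trinomialMean_nonneg hc hw hd fun x y _ _ => hg x y
  induction a generalizing f with
  | succ a ih =>
    rw [show a + 1 + b + e = (a + b + e) + 1 by ring, trinomialMean]
    have h1 := mul_le_mul_of_nonneg_left (ih (f := fun x y => f (x + 1) y) fun _ _ => hf _ _) hc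
    have h2 := mul_nonneg hw (key (a + b + e) (g := fun x y => f x (y + 1)) fun _ _ => hf _ _)
    have h3 := mul_nonneg hd (key (a + b + e) hf)
    rw [pow_succ]
    linarith
  | zero =>
    induction b generalizing f with
    | succ b ih =>
      rw [show 0 + (b + 1) + e = (0 + b + e) + 1 by ring, trinomialMean]
      have h1 := mul_le_mul_of_nonneg_left (ih (f := fun x y => f x (y + 1)) fun _ _ => hf _ _) hw
      have h2 := mul_nonneg hc (key (0 + b + e) (g := fun x y => f (x + 1) y) fun _ _ => hf _ _)
      have h3 := mul_nonneg hd (key (0 + b + e) hf)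
      rw [pow_succ]
      linarith
    | zero =>
      induction e with
      | zero => simp [trinomialMean]
      | succ e ih =>
        rw [show 0 + 0 + (e + 1) = (0 + 0 + e) + 1 by ring, trinomialMean]
        have h1 := mul_le_mul_of_nonneg_left ih hd
        have h2 := mul_nonneg hc (key (0 + 0 + e) (g := fun x y => f (x + 1) y) fun _ _ => hf _ _)
        have h3 := mul_nonneg hw (key (0 + 0 + e) (g := fun x y => f x (y + 1)) fun _ _ => hf _ _)
        rw [pow_succ]
        linarith

theorem trinomialMean_swap (n : ℕ) (f : ℕ → ℕ → ℝ) :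
    trinomialMean c w d n f = trinomialMean w c d n (fun x y => f y x) := by
  induction n generalizing f with
  | zero => rfl
  | succ n ih =>
    simp only [trinomialMean]
    rw [ih f, ih fun x y => f (x + 1) y, ih fun x y => f x (y + 1)]
    ring

/-- The change of measure between different weights of the first two outcomes. -/
theorem trinomialMean_tilt (n : ℕ) (f : ℕ → ℕ → ℝ) :
    trinomialMean c w d n f = trinomialMean 1 1 d n (fun x y => c ^ x * w ^ y * f x y) := by
  have h (n : ℕ) (f g : ℕ → ℕ → ℝ) (r : ℝ) (hg : ∀ x y, g x y = r * f x y) :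
      trinomialMean 1 1 d n g = r * trinomialMean 1 1 d n f := by
    rw [← trinomialMean_mul_left]
    exact congrArg _ (funext₂ hg)
  induction n generalizing f with
  | zero => simp [trinomialMean]
  | succ n ih =>
    simp only [trinomialMean]
    rw [ih f, ih fun x y => f (x + 1) y, ih fun x y => f x (y + 1),
      h n (fun x y => c ^ x * w ^ y * f (x + 1) y) (fun x y => c ^ (x + 1) * w ^ y * f (x + 1) y) c
        fun x y => by ring,
      h n (fun x y => c ^ x * w ^ y * f x (y + 1)) (fun x y => c ^ x * w ^ (y + 1) * f x (y + 1)) w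
        fun x y => by ring]
    ring

/-- Under equal weights the counts `(x, y)` and `(y, x)` are equally likely, so that it is enough
to compare the contributions of such a pair. -/
theorem trinomialMean_nonneg_of_symm (hd : 0 ≤ d) {n : ℕ} {f : ℕ → ℕ → ℝ}
    (h : ∀ x y, x + y ≤ n → (d = 0 → x + y = n) →
      0 ≤ c ^ x * w ^ y * f x y + c ^ y * w ^ x * f y x) :
    0 ≤ trinomialMean c w d n f := by
  have h1 := trinomialMean_nonneg zero_le_one zero_le_one hd h
  rw [trinomialMean_add, ← trinomialMean_tilt,
    trinomialMean_swap n fun x y => c ^ y * w ^ x * f y x, ← trinomialMean_tilt] at h1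
  linarith

/-- By exchangeability, the sum over the trials with the first outcome is a multiple of the
contribution of one such trial. -/
theorem trinomialMean_fst_mul (n : ℕ) (f : ℕ → ℕ → ℝ) :
    trinomialMean c w d (n + 1) (fun x y => x * f x y) =
      (n + 1) * c * trinomialMean c w d n (fun x y => f (x + 1) y) := by
  induction n generalizing f with
  | zero => simp [trinomialMean]
  | succ n ih =>
    have h1 : trinomialMean c w d (n + 1) (fun x y => ((x + 1 : ℕ) : ℝ) * f (x + 1) y) =
        (n + 1) * c * trinomialMean c w d n (fun x y => f (x + 1 + 1) y) +
          trinomialMean c w d (n + 1) (fun x y => f (x + 1) y) := by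
      rw [← ih fun x y => f (x + 1) y, ← trinomialMean_add]
      congr 1
      ext x y
      push_cast
      ring
    rw [trinomialMean, h1, ih f, ih fun x y => f x (y + 1)]
    conv_rhs => rw [trinomialMean]
    rw [trinomialMean]
    push_cast
    ring

theorem trinomialMean_snd_mul (n : ℕ) (f : ℕ → ℕ → ℝ) :
    trinomialMean c w d (n + 1) (fun x y => y * f x y) =
      (n + 1) * w * trinomialMean c w d n (fun x y => f x (y + 1)) := by
  rw [trinomialMean_swap, trinomialMean_fst_mul n fun x y => f y x, trinomialMean_swap n]

/-- Moving weight from the second to the first outcome raises the mean of a function that prefers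
the first. -/
theorem trinomialMean_le_of_shift {c' w' : ℝ} (hc : 0 ≤ c) (hw' : 0 ≤ w') (hd : 0 ≤ d)
    (hcc : c ≤ c') (hsum : c' + w' = c + w) (n : ℕ) {f : ℕ → ℕ → ℝ}
    (hf : ∀ x y, f x (y + 1) ≤ f (x + 1) y) :
    trinomialMean c w d n f ≤ trinomialMean c' w' d n f := by
  have hw : 0 ≤ w := by linarith
  induction n generalizing f with
  | zero => exact le_rfl
  | succ n ih =>
    simp only [trinomialMean]
    have h1 := mul_le_mul_of_nonneg_left (ih (f := fun x y => f (x + 1) y) fun _ _ => hf _ _)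
      (hc.trans hcc)
    have h2 := mul_le_mul_of_nonneg_left (ih (f := fun x y => f x (y + 1)) fun _ _ => hf _ _) hw'
    have h3 := mul_le_mul_of_nonneg_left (ih hf) hd
    have h4 : trinomialMean c w d n (fun x y => f x (y + 1)) ≤
        trinomialMean c w d n (fun x y => f (x + 1) y) :=
      trinomialMean_mono hc hw hd fun x y _ _ => hf x y
    have h5 := mul_le_mul_of_nonneg_left h4 (sub_nonneg.2 hcc)
    obtain rfl : w' = c + w - c' := by linarith
    linarith

theorem continuous_trinomialMean (n : ℕ) (f : ℕ → ℕ → ℝ) :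
    Continuous fun r : ℝ × ℝ × ℝ => trinomialMean r.1 r.2.1 r.2.2 n f := by
  induction n generalizing f with
  | zero => exact continuous_const
  | succ n ih =>
    simp only [trinomialMean]
    exact ((continuous_fst.mul (ih _)).add ((continuous_fst.comp continuous_snd).mul (ih _))).add
      ((continuous_snd.comp continuous_snd).mul (ih _))

/-- Each of the `n + 1` trials contributes to the derivative with respect to the weights what a
change of that single trial would. -/
theorem hasDerivAt_trinomialMean (c' w' d' : ℝ) (n : ℕ) (f : ℕ → ℕ → ℝ) :
    HasDerivAt (fun t : ℝ => trinomialMean (c + t * c') (w + t * w') (d + t * d') (n + 1) f)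
      ((n + 1) * (c' * trinomialMean c w d n (fun x y => f (x + 1) y) +
        w' * trinomialMean c w d n (fun x y => f x (y + 1)) + d' * trinomialMean c w d n f)) 0 := by
  have hlin (a b : ℝ) : HasDerivAt (fun t : ℝ => a + t * b) b 0 := by
    simpa using ((hasDerivAt_id (0 : ℝ)).mul_const b).const_add a
  induction n generalizing f with
  | zero =>
    have h := (((hlin c c').mul_const (f 1 0)).add ((hlin w w').mul_const (f 0 1))).add
      ((hlin d d').mul_const (f 0 0))
    refine h.congr_deriv ?_
    simp [trinomialMean]
  | succ n ih =>
    have h := (((hlin c c').mul (ih fun x y => f (x + 1) y)).add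
      ((hlin w w').mul (ih fun x y => f x (y + 1)))).add ((hlin d d').mul (ih f))
    simp only [zero_mul, add_zero] at h
    refine h.congr_deriv ?_
    simp only [trinomialMean]
    push_cast
    ring

end Trinomial

/-! ### The outcome of the vote under given actions -/

section Outcome

variable {N : ℕ}

theorem mean_congr {α : Type*} {s : Finset α} {f g : α → ℝ} (h : ∀ x ∈ s, f x = g x) :
    mean s f = mean s g := by
  rw [mean, mean, Finset.sum_congr rfl h]

theorem mean_singleton {α : Type*} (x : α) (f : α → ℝ) : mean {x} f = f x := by
  simp [mean]

theorem mean_const {α : Type*} {s : Finset α} (hs : s.Nonempty) (r : ℝ) :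
    mean s (fun _ => r) = r := by
  have : (s.card : ℝ) ≠ 0 := by exact_mod_cast hs.card_pos.ne'
  simp [mean, this]

theorem mean_piFinset_update (s : Fin N → Finset (Fin N)) (i : Fin N) (g : Fin N → Fin N)
    (hs : ∀ j ≠ i, s j = {g j}) (f : (Fin N → Fin N) → ℝ) :
    mean (Fintype.piFinset s) f = mean (s i) fun t => f (Function.update g i t) := by
  have h : Fintype.piFinset s = (s i).map ⟨Function.update g i, Function.update_injective g i⟩ := by
    ext g'
    simp only [Fintype.mem_piFinset, Finset.mem_map, Function.Embedding.coeFn_mk]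
    constructor
    · intro hg
      refine ⟨g' i, hg i, funext fun j => ?_⟩
      by_cases hj : j = i
      · subst hj; simp
      · have := hg j
        rw [hs j hj, Finset.mem_singleton] at this
        simp [hj, this]
    · rintro ⟨t, ht, rfl⟩ j
      by_cases hj : j = i
      · subst hj; simpa using ht
      · simp [hj, hs j hj]
  rw [mean, mean, h, Finset.sum_map, Finset.card_map]
  rfl

/-- If every packet gets to a voter who casts it, there is nothing to resolve. -/
theorem resolve_eq_of_forall_not_circular (cat : Fin N → Finset (Fin N))
    (val : (Fin N → Fin N) → ℝ) (g : Fin N → Fin N) (hg : ∀ v, ¬ Circular g v) (n : ℕ) :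
    resolve cat val n g = val g := by
  cases n with
  | zero => rfl
  | succ n =>
    have : ¬ (redirectable cat g).Nonempty := by
      rintro ⟨u, hu⟩
      simp only [redirectable, Finset.mem_filter] at hu
      exact hg u hu.2.1
    rw [resolve, if_neg this]

theorem iterate_eq_of_fixed {g : Fin N → Fin N} {v x : Fin N} {m n : ℕ} (hm : g^[m] v = x)
    (hx : g x = x) (hn : g (g^[n] v) = g^[n] v) : g^[n] v = x := by
  have h1 : g^[n + m] v = x := by
    rw [Function.iterate_add_apply, hm, Function.iterate_fixed hx]
  rw [Nat.add_comm, Function.iterate_add_apply, Function.iterate_fixed hn] at h1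
  exact h1

/-- The votes cast for `d` when the packet of each voter `v` ends up with `r v`. -/
theorem tally_eq_of_roots (a : Fin N → Action) {g r : Fin N → Fin N}
    (hr : ∀ v, ∃ n, g^[n] v = r v) (hfix : ∀ v, g (r v) = r v) (d : Bool) :
    tally a g d = (Finset.univ.filter fun v => a (r v) = .vote d).card := by
  rw [tally]
  congr 1
  ext v
  simp only [Finset.mem_filter, Finset.mem_univ, true_and]
  obtain ⟨m, hm⟩ := hr v
  constructor
  · rintro ⟨n, hn, ha⟩
    rwa [iterate_eq_of_fixed hm (hfix v) hn] at ha
  · intro ha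
    exact ⟨m, by rw [hm, hfix], by rwa [hm]⟩

/-- The number of voters who cast a vote for `d` themselves. -/
def ballots (a : Fin N → Action) (d : Bool) : ℕ :=
  (Finset.univ.filter fun v => a v = .vote d).card

/-- Whether the decision is correct in the state `ω` (`1` if so, `0` if not) when the voter `e`
casts a vote and all delegated votes go to her: the voters who oppose her must form a majority to
overrule her. -/
noncomputable def outcome (e : Fin N) (a : Fin N → Action) (ω : Bool) : ℝ :=
  if a e = .vote ω then (if ballots a (!ω) ≤ N / 2 then 1 else 0)
  else (if N / 2 < ballots a ω then 1 else 0)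

/-- The votes are counted as `outcome` says also if `a` is only equivalent to a profile `b` of
votes and delegations to `e`, in the sense that the packet of each voter is cast as under `b`. -/
theorem majorityCorrect_eq_outcome (hN : Odd N) {e : Fin N} {a b : Fin N → Action}
    {g r : Fin N → Fin N} (hr : ∀ v, ∃ n, g^[n] v = r v) (hfix : ∀ v, g (r v) = r v)
    {d : Bool} (hbe : b e = .vote d) (hb : ∀ v, b v ≠ .toNonExpert)
    (hab : ∀ v, a (r v) = if b v = .toExpert then b e else b v) (ω : Bool) :
    majorityCorrect a ω g = outcome e b ω := by
  have hvote (v : Fin N) : a (r v) = .vote ω ∨ a (r v) = .vote (!ω) := by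
    rw [hab, hbe]
    have := hb v
    rcases h : b v with d' | _ | _
    · rcases d' <;> rcases ω <;> simp
    · rcases d <;> rcases ω <;> simp
    · exact absurd h this
  have htot : tally a g ω + tally a g (!ω) = N := by
    rw [tally_eq_of_roots a hr hfix, tally_eq_of_roots a hr hfix, ← Finset.card_union_of_disjoint]
    · rw [← Finset.filter_or, Finset.filter_true_of_mem fun v _ => hvote v]
      simp
    · rw [Finset.disjoint_filter]
      intro v _ h1 h2
      rw [h1] at h2
      simp at h2
  have hopp (x : Bool) (hx : x ≠ d) : tally a g x = ballots b x := by
    rw [tally_eq_of_roots a hr hfix, ballots]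
    congr 1
    ext v
    simp only [Finset.mem_filter, Finset.mem_univ, true_and]
    rw [hab, hbe]
    split_ifs with h
    · simp [h, hx.symm]
    · rfl
  obtain ⟨m, hm⟩ := hN
  have hdiv : N / 2 = m := by omega
  rw [majorityCorrect, outcome, hdiv, hbe]
  by_cases hd : d = ω
  · subst hd
    have := hopp (!d) (by simp)
    simp only [if_true]
    split_ifs <;> first | rfl | omega
  · have := hopp ω (Ne.symm hd)
    have hd' : Action.vote d ≠ .vote ω := by simpa using hd
    simp only [if_neg hd']
    split_ifs <;> first | rfl | omega

theorem targets_toExpert {e i : Fin N} (h : i ≠ e) : targets {e} i .toExpert = {e} := by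
  rw [targets, Finset.erase_eq_of_notMem (by simpa using h)]

/-- Without delegation to non-experts, each voter other than `e` has one target. -/
theorem targets_eq_singleton {e v : Fin N} {x : Action} (hv : v ≠ e) (hx : x ≠ .toNonExpert) :
    targets {e} v x = {if x = .toExpert then e else v} := by
  rcases x with d | _ | _
  · simp [targets]
  · simp [targets_toExpert hv]
  · exact absurd rfl hx

theorem correctProb_of_toExpert (hN : Odd N) {e : Fin N} {a : Fin N → Action} {d : Bool}
    (he : a e = .vote d) (ha : ∀ v, a v ≠ .toNonExpert) (ω : Bool) :
    correctProb {e} a ω = outcome e a ω := by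
  set g : Fin N → Fin N := fun v => if a v = .toExpert then e else v with hg
  have hge : g e = e := by simp [hg]
  have hfix (v) : g (g v) = g v := by
    by_cases h : a v = .toExpert <;> simp [hg, h]
  rw [correctProb, mean_piFinset_update _ e g fun j hj => targets_eq_singleton hj (ha j), he,
    targets, mean_singleton]
  have : Function.update g e e = g := by
    rw [Function.update_eq_iff]; exact ⟨hge.symm, fun _ _ => rfl⟩
  rw [this, resolve_eq_of_forall_not_circular _ _ g fun v hv => hv 1 (hfix v)]
  refine majorityCorrect_eq_outcome hN (r := g) (fun v => ⟨1, rfl⟩) hfix he ha (fun v => ?_) ω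
  by_cases h : a v = .toExpert <;> simp [hg, h]

/-- A voter who delegates to `t`, who does not delegate to her, might as well copy the action
of `t`. -/
theorem correctProb_of_toNonExpert (hN : Odd N) {e i : Fin N} (hie : i ≠ e) {a : Fin N → Action}
    {d : Bool} (he : a e = .vote d) (hi : a i = .toNonExpert) (ha : ∀ v ≠ i, a v ≠ .toNonExpert)
    (ω : Bool) :
    correctProb {e} a ω =
      mean (({e}ᶜ : Finset (Fin N)).erase i) fun t => outcome e (Function.update a i (a t)) ω := by
  set g : Fin N → Fin N := fun v => if a v = .toExpert then e else v with hg
  have hge : g e = e := by simp [hg]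
  have hfix (v) : g (g v) = g v := by
    by_cases h : a v = .toExpert <;> simp [hg, h]
  have htar (j) (hj : j ≠ i) : targets {e} j (a j) = {g j} := by
    by_cases hje : j = e
    · subst hje; simp [he, targets, hge]
    · exact targets_eq_singleton hje (ha j hj)
  rw [correctProb, mean_piFinset_update _ i g htar, hi, targets]
  refine mean_congr fun t ht => ?_
  have hti : t ≠ i := Finset.ne_of_mem_erase ht
  have hgi (v) (hv : v ≠ i) : g v ≠ i := by
    by_cases h : a v = .toExpert
    · simpa [hg, h] using hie.symm
    · simpa [hg, h] using hv
  set g' := Function.update g i t with hg'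
  have hne (v) (hv : v ≠ i) : g' v = g v := by simp [hg', hv]
  have hgi' : g' i = t := by simp [hg']
  set r : Fin N → Fin N := fun v => if v = i then g t else g v with hr
  have hroot (v) : ∃ n, g'^[n] v = r v := by
    by_cases hv : v = i
    · exact ⟨2, by simp [hr, hv, hgi', hne t hti]⟩
    · exact ⟨1, by simp [hr, hv, hne v hv]⟩
  have hfix' (v) : g' (r v) = r v := by
    by_cases hv : v = i
    · simp [hr, hv, hne _ (hgi t hti), hfix]
    · simp [hr, hv, hne _ (hgi v hv), hfix]
  rw [resolve_eq_of_forall_not_circular _ _ _ fun v hv => ?_]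
  · refine majorityCorrect_eq_outcome hN hroot hfix' (d := d) (by simp [hie.symm, he])
      (fun v => ?_) (fun v => ?_) ω
    · by_cases hv : v = i
      · subst hv; simpa using ha t hti
      · simpa [hv] using ha v hv
    · by_cases hv : v = i
      · subst hv
        by_cases h : a t = .toExpert <;> simp [hr, hg, h, hie.symm]
      · by_cases h : a v = .toExpert <;> simp [hr, hg, h, hie.symm, hv]
  · obtain ⟨n, hn⟩ := hroot v
    exact hv n (by rw [hn, hfix'])

/-- If the expert `e` delegates, all delegated votes end up with a random non-expert who votes:
either she delegates to such a voter, or the votes run in a circle, of which only her link can be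
redirected. -/
theorem correctProb_of_expert_delegates (hN : Odd N) {e : Fin N} {a : Fin N → Action}
    (he : a e = .toNonExpert) (ha : ∀ v ≠ e, a v ≠ .toNonExpert) (hne : ∃ v, v ≠ e) (ω : Bool) :
    correctProb {e} a ω =
      if (Finset.univ.filter fun v => v ≠ e ∧ a v ≠ .toExpert).Nonempty then
        mean (Finset.univ.filter fun v => v ≠ e ∧ a v ≠ .toExpert) fun t =>
          outcome e (Function.update a e (a t)) ω
      else 1 / 2 := by
  set V := Finset.univ.filter fun v => v ≠ e ∧ a v ≠ .toExpert with hV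
  set g : Fin N → Fin N := fun v => if a v = .toExpert then e else v with hg
  have hmemV (v) : v ∈ V ↔ v ≠ e ∧ a v ≠ .toExpert := by simp [hV]
  have hge (t) : Function.update g e t e = t := by simp
  have hgV (t v) (hv : v ∈ V) : Function.update g e t v = v := by
    rw [hmemV] at hv; simp [hv.1, hg, hv.2]
  have hgD (t v) (hve : v ≠ e) (hv : v ∉ V) : Function.update g e t v = e := by
    have : a v = .toExpert := by by_contra h; exact hv ((hmemV v).2 ⟨hve, h⟩)
    simp [hve, hg, this]
  have heV : e ∉ V := by simp [hmemV]
  have hvoteV (v) (hv : v ∈ V) : ∃ d, a v = .vote d := by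
    rw [hmemV] at hv
    rcases h : a v with d | _ | _
    · exact ⟨d, rfl⟩
    · exact absurd h hv.2
    · exact absurd h (ha v hv.1)
  -- The packet of `e` reaches the voter `t`.
  have hcast (t) (ht : t ∈ V) (cat : Fin N → Finset (Fin N)) (n : ℕ) (g' : Fin N → Fin N)
      (hV' : ∀ v ∈ V, g' v = v) (hroot : ∀ v ∉ V, ∃ m, g'^[m] v = t) :
      resolve cat (majorityCorrect a ω) n g' = outcome e (Function.update a e (a t)) ω := by
    obtain ⟨d, hd⟩ := hvoteV t ht
    set r : Fin N → Fin N := fun v => if v ∈ V then v else t with hr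
    have hroot' (v) : ∃ m, g'^[m] v = r v := by
      by_cases hv : v ∈ V
      · exact ⟨0, by simp [hr, hv]⟩
      · simpa [hr, hv] using hroot v hv
    have hfix (v) : g' (r v) = r v := by
      by_cases hv : v ∈ V
      · simpa [hr, hv] using hV' v hv
      · simpa [hr, hv] using hV' t ht
    rw [resolve_eq_of_forall_not_circular _ _ _ fun v hv => ?_]
    · refine majorityCorrect_eq_outcome hN hroot' hfix (d := d) (by simp [hd])
        (fun v => ?_) (fun v => ?_) ω
      · by_cases hv : v = e
        · subst hv; simp [hd]
        · simpa [hv] using ha v hv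
      · by_cases hv : v = e
        · subst hv; simp [hr, heV, hd]
        · by_cases h : a v = .toExpert <;> simp [hr, hmemV, hv, h]
    · obtain ⟨m, hm⟩ := hroot' v
      exact hv m (by rw [hm, hfix])
  have htar (j) (hj : j ≠ e) : targets {e} j (a j) = {g j} := targets_eq_singleton hj (ha j hj)
  have hval (t) (hte : t ≠ e) :
      resolve (fun i => category {e} (a i)) (majorityCorrect a ω) N (Function.update g e t) =
      if V.Nonempty then (if t ∈ V then outcome e (Function.update a e (a t)) ω else
        mean V fun t => outcome e (Function.update a e (a t)) ω) else 1 / 2 := by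
    by_cases htV : t ∈ V
    · rw [if_pos ⟨t, htV⟩, if_pos htV]
      refine hcast t htV _ _ _ (hgV t) fun v hv => ?_
      by_cases hve : v = e
      · exact ⟨1, by simp [hve]⟩
      · exact ⟨2, by simp [hgD t v hve hv]⟩
    · rw [if_neg htV]
      set g' := Function.update g e t with hg'
      have hg'' (v) (hv : v ∉ V) : g' v ∉ V ∧ g' v ≠ v := by
        by_cases hve : v = e
        · subst hve; rw [hg', hge]; exact ⟨htV, hte⟩
        · rw [hg', hgD t v hve hv]; exact ⟨heV, Ne.symm hve⟩
      have hit (v) (hv : v ∉ V) (n : ℕ) : g'^[n] v ∉ V := by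
        induction n with
        | zero => exact hv
        | succ n ih => rw [Function.iterate_succ_apply']; exact (hg'' _ ih).1
      have hitV (v) (hv : v ∈ V) (n : ℕ) : g'^[n] v = v := Function.iterate_fixed (hgV t v hv) n
      have hcirc (v) : Circular g' v ↔ v ∉ V := by
        constructor
        · intro h hv
          exact h 0 (hgV t v hv)
        · intro hv n
          exact (hg'' _ (hit v hv n)).2
      have hreach (v) (hv : v ∉ V) : ∃ n, g'^[n] v = e := by
        by_cases hve : v = e
        · exact ⟨0, hve⟩
        · exact ⟨1, hgD t v hve hv⟩
      have hflow (v) (hv : v ∉ V) (u) : u ∈ flow g' v ↔ u ∉ V := by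
        simp only [flow, Finset.mem_filter, Finset.mem_univ, true_and]
        constructor
        · rintro ⟨m, n, h⟩ hu
          rw [hitV u hu] at h
          exact hit v hv n (h ▸ hu)
        · intro hu
          obtain ⟨m, hm⟩ := hreach u hu
          obtain ⟨n, hn⟩ := hreach v hv
          exact ⟨m, n, hm.trans hn.symm⟩
      have hcate : category {e} (a e) \ flow g' e = V := by
        rw [he]
        ext u
        simp only [category, Finset.mem_sdiff, Finset.mem_compl, Finset.mem_singleton,
          hflow e heV, not_not]
        exact ⟨fun h => h.2, fun h => ⟨((hmemV u).1 h).1, h⟩⟩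
      have hcatD (v) (hve : v ≠ e) (hv : v ∉ V) : category {e} (a v) \ flow g' v = ∅ := by
        have : a v = .toExpert := by by_contra h; exact hv ((hmemV v).2 ⟨hve, h⟩)
        rw [this, category]
        ext u
        simp only [Finset.mem_sdiff, Finset.mem_singleton, hflow v hv, not_not,
          Finset.notMem_empty, iff_false, not_and]
        rintro rfl
        exact heV
      obtain ⟨n, rfl⟩ : ∃ n, N = n + 1 := ⟨N - 1, by have := hN.pos; omega⟩
      rw [resolve]
      split_ifs with h1 h2 h2
      · have hred : redirectable (fun i => category {e} (a i)) g' = {e} := by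
          ext u
          simp only [redirectable, Finset.mem_filter, Finset.mem_univ, true_and, hcirc,
            Finset.mem_singleton]
          constructor
          · rintro ⟨hu, hu'⟩
            by_contra hue
            rw [hcatD u hue hu] at hu'
            exact Finset.not_nonempty_empty hu'
          · rintro rfl
            exact ⟨heV, by rwa [hcate]⟩
        rw [hred, mean_singleton, hcate]
        refine mean_congr fun x hx => ?_
        refine hcast x hx _ _ _ (fun v hv => ?_) fun v hv => ⟨1, ?_⟩
        · rw [redirect, if_neg (by simpa [hflow e heV] using hv), hg', hgV t v hv]
        · simp [redirect, hflow e heV, hv]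
      · obtain ⟨u, hu⟩ := h1
        simp only [redirectable, Finset.mem_filter, Finset.mem_univ, true_and, hcirc] at hu
        exfalso
        by_cases hue : u = e
        · subst hue
          rw [hcate] at hu
          exact h2 hu.2
        · rw [hcatD u hue hu.1] at hu
          exact Finset.not_nonempty_empty hu.2
      · exfalso
        refine h1 ⟨e, ?_⟩
        simp only [redirectable, Finset.mem_filter, Finset.mem_univ, true_and, hcirc]
        exact ⟨heV, by rwa [hcate]⟩
      · have htally (d) : tally a g' d = 0 := by
          simp only [tally, Finset.card_eq_zero, Finset.filter_eq_empty_iff]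
          rintro v - ⟨m, hm, -⟩
          exact (hcirc v).2 (fun hv => h2 ⟨v, hv⟩) m hm
        simp [majorityCorrect, htally]
  rw [correctProb, mean_piFinset_update _ e g htar, he, targets]
  have hT : (({e}ᶜ : Finset (Fin N)).erase e) = {e}ᶜ := Finset.erase_eq_of_notMem (by simp)
  rw [hT]
  have hTne : ({e}ᶜ : Finset (Fin N)).Nonempty := by
    obtain ⟨v, hv⟩ := hne
    exact ⟨v, by simpa using hv⟩
  rw [mean_congr fun t ht => hval t (by simpa using ht)]
  split_ifs with hVne
  · have hsub : V ⊆ {e}ᶜ := fun v hv => by simpa using ((hmemV v).1 hv).1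
    have hVc : (V.card : ℝ) ≠ 0 := by exact_mod_cast hVne.card_pos.ne'
    have hTc : ((({e}ᶜ : Finset (Fin N)).card : ℕ) : ℝ) ≠ 0 := by exact_mod_cast hTne.card_pos.ne'
    generalize hR : (fun t => outcome e (Function.update a e (a t)) ω) = R
    have hR' (t) : outcome e (Function.update a e (a t)) ω = R t := congrFun hR t
    simp only [hR']
    rw [mean, Finset.sum_ite, Finset.filter_mem_eq_inter, Finset.inter_eq_right.2 hsub,
      Finset.sum_const, nsmul_eq_mul, Finset.filter_notMem_eq_sdiff,
      Finset.card_sdiff_of_subset hsub, Nat.cast_sub (Finset.card_le_card hsub), mean]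
    field_simp
    ring
  · exact mean_const hTne _

end Outcome

/-! ### Random actions -/

section Lottery

variable {N : ℕ}

theorem sum_action {R : Type*} [AddCommMonoid R] (ω : Bool) (f : Action → R) :
    ∑ b, f b = f (.vote ω) + f (.vote !ω) + f .toExpert + f .toNonExpert := by
  have h : (Finset.univ : Finset Action) = {.vote ω, .vote !ω, .toExpert, .toNonExpert} := by
    cases ω <;> decide
  rw [h, Finset.sum_insert (by simp), Finset.sum_insert (by simp), Finset.sum_insert (by simp),
    Finset.sum_singleton]
  simp only [add_assoc]

/-- The mean of `F` when the actions are independently drawn from the lotteries `ρ i`. -/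
noncomputable def lotteryMean (ρ : Fin N → Action → ℝ) (F : (Fin N → Action) → ℝ) : ℝ :=
  ∑ a : Fin N → Action, (∏ i, ρ i (a i)) * F a

/-- The mean is linear in the lottery of each voter. -/
theorem lotteryMean_eq_sum (ρ : Fin N → Action → ℝ) (F : (Fin N → Action) → ℝ) (i : Fin N) :
    lotteryMean ρ F = ∑ b, ρ i b * lotteryMean (Function.update ρ i (play b)) F := by
  have h (b : Action) (a : Fin N → Action) :
      ∏ j, Function.update ρ i (play b) j (a j) =
        play b (a i) * ∏ j ∈ Finset.univ.erase i, ρ j (a j) := by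
    rw [← Finset.mul_prod_erase _ _ (Finset.mem_univ i), Function.update_self]
    congr 1
    refine Finset.prod_congr rfl fun j hj => ?_
    rw [Function.update_of_ne (Finset.ne_of_mem_erase hj)]
  simp only [lotteryMean, h, Finset.mul_sum]
  rw [Finset.sum_comm]
  refine Finset.sum_congr rfl fun a _ => ?_
  rw [Finset.sum_eq_single (a i) (fun b _ hb => by simp [play, hb.symm]) (by simp),
    ← Finset.mul_prod_erase _ _ (Finset.mem_univ i)]
  simp [play, mul_assoc]

theorem lotteryMean_play (a : Fin N → Action) (F : (Fin N → Action) → ℝ) :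
    lotteryMean (fun i => play (a i)) F = F a := by
  rw [lotteryMean, Finset.sum_eq_single a]
  · simp [play]
  · intro b _ hb
    obtain ⟨i, hi⟩ := Function.ne_iff.1 hb
    rw [Finset.prod_eq_zero (Finset.mem_univ i) (by simp [play, hi]), zero_mul]
  · simp

/-- The lottery `l` votes for `ω` with weight `c`, for the other decision with weight `w`,
delegates to an expert with weight `d`, and never delegates to a non-expert. -/
structure HasWeights (ω : Bool) (c w d : ℝ) (l : Action → ℝ) : Prop where
  vote : l (.vote ω) = c
  vote_not : l (.vote !ω) = w
  toExpert : l .toExpert = d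
  toNonExpert : l .toNonExpert = 0

theorem HasWeights.sum_mul {ω : Bool} {c w d : ℝ} {l : Action → ℝ} (h : HasWeights ω c w d l)
    (f : Action → ℝ) :
    ∑ b, l b * f b = c * f (.vote ω) + w * f (.vote !ω) + d * f .toExpert := by
  rw [sum_action ω, h.vote, h.vote_not, h.toExpert, h.toNonExpert]
  ring

/-- If the voters in `J` use the same lottery and the others a fixed action, and only the numbers of
votes from `J` for either decision matter, then the mean is over independent three-way trials. -/
theorem lotteryMean_eq_trinomialMean {ω : Bool} {c w d : ℝ} (J : Finset (Fin N))
    {ρ : Fin N → Action → ℝ} {a₀ : Fin N → Action} {F : (Fin N → Action) → ℝ} {f : ℕ → ℕ → ℝ}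
    (hJ : ∀ i ∈ J, HasWeights ω c w d (ρ i)) (hout : ∀ i ∉ J, ρ i = play (a₀ i))
    (hF : ∀ a, (∀ i ∉ J, a i = a₀ i) → (∀ i ∈ J, a i ≠ .toNonExpert) →
      F a = f (J.filter fun i => a i = .vote ω).card (J.filter fun i => a i = .vote !ω).card) :
    lotteryMean ρ F = trinomialMean c w d J.card f := by
  induction J using Finset.induction_on generalizing ρ a₀ f with
  | empty =>
    obtain rfl : ρ = fun i => play (a₀ i) := funext fun i => hout i (Finset.notMem_empty i)
    rw [lotteryMean_play, hF a₀ (fun _ _ => rfl) (by simp)]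
    rfl
  | insert j J hj ih =>
    have key (b : Action) (hb : b ≠ .toNonExpert) (g : ℕ → ℕ → ℝ)
        (hg : ∀ x y, g x y = f (x + if b = .vote ω then 1 else 0)
          (y + if b = .vote !ω then 1 else 0)) :
        lotteryMean (Function.update ρ j (play b)) F = trinomialMean c w d J.card g := by
      refine ih (a₀ := Function.update a₀ j b) (fun i hi => ?_) (fun i hi => ?_)
        fun a ha ha' => ?_
      · rw [Function.update_of_ne (ne_of_mem_of_not_mem hi hj)]
        exact hJ i (Finset.mem_insert_of_mem hi)
      · by_cases hij : i = j
        · subst hij; simp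
        · rw [Function.update_of_ne hij, Function.update_of_ne hij]
          exact hout i (by simp [hij, hi])
      · have haj : a j = b := by simpa using ha j hj
        rw [hF a (fun i hi => ?_) (fun i hi => ?_), hg, Finset.filter_insert, Finset.filter_insert,
          haj]
        · congr 1
          · split_ifs
            · rw [Finset.card_insert_of_notMem (by simp [hj])]
            · rfl
          · split_ifs
            · rw [Finset.card_insert_of_notMem (by simp [hj])]
            · rfl
        · rw [Finset.mem_insert, not_or] at hi
          simpa [hi.1] using ha i hi.2
        · rcases Finset.mem_insert.1 hi with rfl | hi
          · rwa [haj]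
          · exact ha' i hi
    rw [lotteryMean_eq_sum ρ F j, (hJ j (Finset.mem_insert_self j J)).sum_mul,
      Finset.card_insert_of_notMem hj, trinomialMean,
      key (.vote ω) (by simp) (fun x y => f (x + 1) y) (by simp),
      key (.vote !ω) (by simp) (fun x y => f x (y + 1)) (by simp),
      key .toExpert (by simp) f (by simp)]

theorem sum_comp_action {ω : Bool} {J : Finset (Fin N)} {a : Fin N → Action}
    (ha : ∀ t ∈ J, a t ≠ .toNonExpert) (f : Action → ℝ) :
    ∑ t ∈ J, f (a t) = (J.filter fun i => a i = .vote ω).card * f (.vote ω) +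
      (J.filter fun i => a i = .vote !ω).card * f (.vote !ω) +
      (J.card - (J.filter fun i => a i = .vote ω).card -
        (J.filter fun i => a i = .vote !ω).card) * f .toExpert := by
  have h (t) (ht : t ∈ J) : f (a t) = (if a t = .vote ω then 1 else 0) * f (.vote ω) +
      (if a t = .vote !ω then 1 else 0) * f (.vote !ω) +
      (1 - (if a t = .vote ω then 1 else 0) - (if a t = .vote !ω then 1 else 0)) *
        f .toExpert := by
    have := ha t ht
    rcases hat : a t with d | _ | _
    · cases d <;> cases ω <;> simp
    · simp
    · exact absurd hat this
  rw [Finset.sum_congr rfl h]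
  simp only [Finset.sum_add_distrib, Finset.sum_sub_distrib, ← Finset.sum_mul, Finset.sum_boole,
    Finset.sum_const, nsmul_eq_mul, mul_one]

end Lottery

/-! ### The probability of a correct decision -/

/-- The probability of a correct decision if the expert, right with probability `p`, casts all
delegated votes, and of the non-experts `x` vote for the correct and `y` for the wrong decision:
she is overruled if more than `h` voters oppose her. -/
noncomputable def winProb (p : ℝ) (h x y : ℕ) : ℝ :=
  p * (if y ≤ h then 1 else 0) + (1 - p) * (if h < x then 1 else 0)

/-- The probability of a correct decision if a random voter among `x` correct and `y` wrong ones
casts the vote of the expert and all delegated votes. -/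
noncomputable def delegatedWinProb (h x y : ℕ) : ℝ :=
  if x + y = 0 then 1 / 2
  else (x * (if y ≤ h then 1 else 0) + y * (if h < x then 1 else 0)) / (x + y)

section Payoff

variable {k : ℕ} {e : Fin (2 * k + 3)} {ω : Bool} {c w d : ℝ}

theorem odd_two_mul_add_three (k : ℕ) : Odd (2 * k + 3) := ⟨k + 1, by ring⟩

theorem div_two_eq (k : ℕ) : (2 * k + 3) / 2 = k + 1 := by omega

theorem card_compl_singleton (e : Fin (2 * k + 3)) :
    ({e}ᶜ : Finset (Fin (2 * k + 3))).card = 2 * k + 2 := by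
  rw [Finset.card_compl]; simp

theorem card_compl_erase {i : Fin (2 * k + 3)} (hi : i ≠ e) :
    (({e}ᶜ : Finset (Fin (2 * k + 3))).erase i).card = 2 * k + 1 := by
  rw [Finset.card_erase_of_mem (by simpa using hi), card_compl_singleton]; rfl

theorem ballots_eq_of_expert {a : Fin (2 * k + 3) → Action} {x : Bool} (h : a e ≠ .vote x) :
    ballots a x = (({e}ᶜ : Finset _).filter fun v => a v = .vote x).card := by
  rw [ballots]
  congr 1
  ext v
  simp only [Finset.mem_filter, Finset.mem_univ, true_and, Finset.mem_compl, Finset.mem_singleton]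
  exact ⟨fun hv => ⟨fun hve => h (hve ▸ hv), hv⟩, fun hv => hv.2⟩

theorem outcome_eq {a : Fin (2 * k + 3) → Action} {d : Bool} (h : a e = .vote d) :
    outcome e a ω =
      if d = ω then
        (if (({e}ᶜ : Finset _).filter fun v => a v = .vote !ω).card ≤ k + 1 then 1 else 0)
      else (if k + 1 < (({e}ᶜ : Finset _).filter fun v => a v = .vote ω).card then 1 else 0) := by
  rw [outcome, div_two_eq, h]
  by_cases hd : d = ω
  · subst hd
    rw [if_pos rfl, if_pos rfl, ballots_eq_of_expert (e := e) (by simp [h])]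
  · rw [if_neg (by simpa using hd), if_neg hd, ballots_eq_of_expert (e := e) (by simp [h, hd])]

theorem card_filter_compl_eq {i : Fin (2 * k + 3)} (hi : i ≠ e) (a : Fin (2 * k + 3) → Action)
    (b : Action) :
    (({e}ᶜ : Finset _).filter fun v => a v = b).card =
      ((({e}ᶜ : Finset _).erase i).filter fun v => a v = b).card + if a i = b then 1 else 0 := by
  have hmem : i ∈ ({e}ᶜ : Finset (Fin (2 * k + 3))) := by simpa using hi
  conv_lhs => rw [← Finset.insert_erase hmem, Finset.filter_insert]
  split_ifs
  · rw [Finset.card_insert_of_notMem (by simp)]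
  · rfl

variable {p : ℝ} (G : Environment (2 * k + 3)) {ρ : Fin (2 * k + 3) → Action → ℝ}

theorem correctGiven_expert_vote (hE : G.experts = {e}) (d' : Bool)
    (hρ : ∀ j ≠ e, HasWeights ω c w d (ρ j)) :
    G.correctGiven ω (Function.update ρ e (play (.vote d'))) =
      trinomialMean c w d (2 * k + 2) fun x y =>
        if d' = ω then (if y ≤ k + 1 then 1 else 0) else (if k + 1 < x then 1 else 0) := by
  rw [← card_compl_singleton e]
  refine lotteryMean_eq_trinomialMean _ (a₀ := fun _ => .vote d') (ω := ω) (fun i hi => ?_)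
    (fun i hi => ?_) fun a ha ha' => ?_
  · have hi' : i ≠ e := by simpa using hi
    simpa [hi'] using hρ i hi'
  · obtain rfl : i = e := by simpa using hi
    simp
  · have hae : a e = .vote d' := ha e (by simp)
    rw [hE, correctProb_of_toExpert (odd_two_mul_add_three k) hae, outcome_eq hae]
    intro v
    by_cases hv : v = e
    · simp [hv, hae]
    · exact ha' v (by simpa using hv)

theorem correctGiven_expert_delegates (hE : G.experts = {e})
    (hρ : ∀ j ≠ e, HasWeights ω c w d (ρ j)) :
    G.correctGiven ω (Function.update ρ e (play .toNonExpert)) =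
      trinomialMean c w d (2 * k + 2) (delegatedWinProb (k + 1)) := by
  rw [← card_compl_singleton e]
  refine lotteryMean_eq_trinomialMean _ (a₀ := fun _ => .toNonExpert) (ω := ω) (fun i hi => ?_)
    (fun i hi => ?_) fun a ha ha' => ?_
  · have hi' : i ≠ e := by simpa using hi
    simpa [hi'] using hρ i hi'
  · obtain rfl : i = e := by simpa using hi
    simp
  · have hae : a e = .toNonExpert := ha e (by simp)
    have hane (v) (hv : v ≠ e) : a v ≠ .toNonExpert := ha' v (by simpa using hv)
    set J : Finset (Fin (2 * k + 3)) := {e}ᶜ with hJ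
    set X := (J.filter fun v => a v = .vote ω).card with hX
    set Y := (J.filter fun v => a v = .vote !ω).card with hY
    have hV : (Finset.univ.filter fun v => v ≠ e ∧ a v ≠ .toExpert) =
        J.filter fun v => a v ≠ .toExpert := by
      ext v; simp [hJ]
    have hcard : ((J.filter fun v => a v ≠ .toExpert).card : ℝ) = X + Y := by
      have h := sum_comp_action (ω := ω) ha' fun b => if b ≠ .toExpert then 1 else 0
      rw [Finset.sum_boole] at h
      rw [h]
      simp [hX, hY]
    have hcard' : (J.filter fun v => a v ≠ .toExpert).card = X + Y := by exact_mod_cast hcard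
    have hout (t) (ht : t ∈ J.filter fun v => a v ≠ .toExpert) :
        outcome e (Function.update a e (a t)) ω = (fun b => if b = .vote ω then
          (if Y ≤ k + 1 then (1 : ℝ) else 0) else (if k + 1 < X then 1 else 0)) (a t) := by
      rw [Finset.mem_filter] at ht
      have hf (b : Action) : (J.filter fun v => Function.update a e (a t) v = b) =
          J.filter fun v => a v = b := by
        refine Finset.filter_congr fun v hv => ?_
        rw [Function.update_of_ne (by simpa [hJ] using hv)]
      rcases hat : a t with d' | _ | _
      · rw [outcome_eq (d := d') (by simp), ← hat, hf, hf, hat]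
        simp [hX, hY]
      · exact absurd hat ht.2
      · exact absurd hat (ha' t ht.1)
    obtain ⟨v, hv⟩ : ∃ v, v ≠ e := exists_ne e
    rw [hE, correctProb_of_expert_delegates (odd_two_mul_add_three k) hae hane ⟨v, hv⟩, hV,
      delegatedWinProb]
    by_cases h0 : X + Y = 0
    · rw [if_pos h0, if_neg]
      rw [← Finset.card_pos, hcard', h0]
      exact lt_irrefl 0
    · rw [if_neg h0, if_pos (by rw [← Finset.card_pos, hcard']; omega), mean_congr hout, mean,
        hcard, Finset.sum_filter]
      have h := sum_comp_action (ω := ω) ha' fun b => if b ≠ .toExpert then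
        (if b = .vote ω then (if Y ≤ k + 1 then (1 : ℝ) else 0) else
          (if k + 1 < X then 1 else 0)) else 0
      rw [h]
      simp [hX, hY]

/-- A non-expert adds one vote of her own, or one vote to the flow of the expert. -/
theorem correctGiven_nonExpert (hE : G.experts = {e}) {i : Fin (2 * k + 3)} (hi : i ≠ e)
    {b : Action} (hb : b ≠ .toNonExpert) (he : HasWeights ω p (1 - p) 0 (ρ e))
    (hρ : ∀ j ≠ e, j ≠ i → HasWeights ω c w d (ρ j)) :
    G.correctGiven ω (Function.update ρ i (play b)) =
      trinomialMean c w d (2 * k + 1) fun x y => winProb p (k + 1)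
        (x + if b = .vote ω then 1 else 0) (y + if b = .vote !ω then 1 else 0) := by
  have key (d' : Bool) : lotteryMean (Function.update (Function.update ρ i (play b)) e
      (play (.vote d'))) (fun a => correctProb G.experts a ω) =
      trinomialMean c w d (2 * k + 1) fun x y =>
        if d' = ω then (if (y + if b = .vote !ω then 1 else 0) ≤ k + 1 then 1 else 0)
        else (if k + 1 < (x + if b = .vote ω then 1 else 0) then 1 else 0) := by
    rw [← card_compl_erase hi]
    refine lotteryMean_eq_trinomialMean _ (ω := ω)
      (a₀ := fun v => if v = e then .vote d' else b) (fun j hj => ?_) (fun j hj => ?_)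
      fun a ha ha' => ?_
    · rw [Finset.mem_erase, Finset.mem_compl, Finset.mem_singleton] at hj
      simpa [hj.1, hj.2] using hρ j hj.2 hj.1
    · by_cases hje : j = e
      · subst hje; simp
      · obtain rfl : j = i := by
          by_contra hji
          exact hj (by simp [hje, hji])
        simp [hje]
    · have hae : a e = .vote d' := by simpa using ha e (by simp)
      have hai : a i = b := by simpa [hi] using ha i (by simp)
      rw [hE, correctProb_of_toExpert (odd_two_mul_add_three k) hae, outcome_eq hae,
        card_filter_compl_eq hi, card_filter_compl_eq hi, hai]
      intro v
      by_cases hv : v = e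
      · simp [hv, hae]
      · by_cases hvi : v = i
        · subst hvi; rwa [hai]
        · exact ha' v (by simp [hv, hvi])
  have he' : HasWeights ω p (1 - p) 0 (Function.update ρ i (play b) e) := by
    simpa [hi.symm] using he
  rw [Environment.correctGiven, ← lotteryMean, lotteryMean_eq_sum _ _ e, he'.sum_mul, key, key,
    ← trinomialMean_mul_left, ← trinomialMean_mul_left, ← trinomialMean_add, zero_mul, add_zero]
  simp [winProb]

theorem correctGiven_nonExpert_delegates (hE : G.experts = {e}) {i : Fin (2 * k + 3)}
    (hi : i ≠ e) (he : HasWeights ω p (1 - p) 0 (ρ e))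
    (hρ : ∀ j ≠ e, j ≠ i → HasWeights ω c w d (ρ j)) :
    G.correctGiven ω (Function.update ρ i (play .toNonExpert)) =
      trinomialMean c w d (2 * k + 1) fun x y =>
        (x * winProb p (k + 1) (x + 1) y + y * winProb p (k + 1) x (y + 1) +
          (2 * k + 1 - x - y) * winProb p (k + 1) x y) / (2 * k + 1) := by
  have key (d' : Bool) (f : ℕ → ℕ → ℝ) (hf : ∀ x y, f x y =
      if d' = ω then (if y ≤ k + 1 then 1 else 0) else (if k + 1 < x then 1 else 0)) :
      lotteryMean (Function.update (Function.update ρ i (play .toNonExpert)) e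
      (play (.vote d'))) (fun a => correctProb G.experts a ω) =
      trinomialMean c w d (2 * k + 1) fun x y =>
        (x * f (x + 1) y + y * f x (y + 1) + (2 * k + 1 - x - y) * f x y) / (2 * k + 1) := by
    rw [← card_compl_erase hi]
    refine lotteryMean_eq_trinomialMean _ (ω := ω)
      (a₀ := fun v => if v = e then .vote d' else .toNonExpert) (fun j hj => ?_) (fun j hj => ?_)
      fun a ha ha' => ?_
    · rw [Finset.mem_erase, Finset.mem_compl, Finset.mem_singleton] at hj
      simpa [hj.1, hj.2] using hρ j hj.2 hj.1
    · by_cases hje : j = e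
      · subst hje; simp
      · obtain rfl : j = i := by
          by_contra hji
          exact hj (by simp [hje, hji])
        simp [hje]
    · have hae : a e = .vote d' := by simpa using ha e (by simp)
      have hai : a i = .toNonExpert := by simpa [hi] using ha i (by simp)
      have hane (v) (hv : v ≠ i) : a v ≠ .toNonExpert := by
        by_cases hve : v = e
        · simp [hve, hae]
        · exact ha' v (by simp [hv, hve])
      rw [hE, correctProb_of_toNonExpert (odd_two_mul_add_three k) hi hae hai hane, mean,
        card_compl_erase hi]
      set J := ({e}ᶜ : Finset (Fin (2 * k + 3))).erase i with hJ
      set X := (J.filter fun v => a v = .vote ω).card with hX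
      set Y := (J.filter fun v => a v = .vote !ω).card with hY
      have hout (t) : outcome e (Function.update a i (a t)) ω =
          (fun b => f (X + if b = .vote ω then 1 else 0) (Y + if b = .vote !ω then 1 else 0))
            (a t) := by
        have hcount (b : Action) : (J.filter fun v => Function.update a i (a t) v = b).card =
            (J.filter fun v => a v = b).card := by
          congr 1
          refine Finset.filter_congr fun v hv => ?_
          rw [Function.update_of_ne (Finset.ne_of_mem_erase hv)]
        rw [outcome_eq (d := d') (by simp [hi.symm, hae]), card_filter_compl_eq hi,
          card_filter_compl_eq hi, hcount, hcount, Function.update_self, ← hX, ← hY]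
        simp only [hf]
      have h := sum_comp_action (ω := ω) ha' fun b =>
        f (X + if b = .vote ω then 1 else 0) (Y + if b = .vote !ω then 1 else 0)
      simp only [hout]
      rw [h, card_compl_erase hi]
      simp [hX, hY]
  have he' : HasWeights ω p (1 - p) 0 (Function.update ρ i (play .toNonExpert) e) := by
    simpa [hi.symm] using he
  rw [Environment.correctGiven, ← lotteryMean, lotteryMean_eq_sum _ _ e, he'.sum_mul,
    key ω (fun x y => if y ≤ k + 1 then 1 else 0) (by simp),
    key (!ω) (fun x y => if k + 1 < x then 1 else 0) (by simp),
    ← trinomialMean_mul_left, ← trinomialMean_mul_left, ← trinomialMean_add, zero_mul, add_zero]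
  congr 1
  ext x y
  simp only [winProb]
  ring

theorem correctGiven_eq (hE : G.experts = {e}) (he : HasWeights ω p (1 - p) 0 (ρ e))
    (hρ : ∀ j ≠ e, HasWeights ω c w d (ρ j)) :
    G.correctGiven ω ρ = trinomialMean c w d (2 * k + 2) (winProb p (k + 1)) := by
  obtain ⟨i, hi⟩ : ∃ i, i ≠ e := exists_ne e
  have hb (b : Action) (hb : b ≠ .toNonExpert) :=
    correctGiven_nonExpert G hE hi hb he fun j hj _ => hρ j hj
  rw [Environment.correctGiven, ← lotteryMean, lotteryMean_eq_sum _ _ i, (hρ i hi).sum_mul]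
  have h1 := hb (.vote ω) (by simp)
  have h2 := hb (.vote !ω) (by simp)
  have h3 := hb .toExpert (by simp)
  rw [Environment.correctGiven, ← lotteryMean] at h1 h2 h3
  rw [h1, h2, h3]
  conv_rhs => rw [show 2 * k + 2 = 2 * k + 1 + 1 from rfl, trinomialMean]
  simp

end Payoff

/-! ### Comparing the available actions -/

/-- The value of a single vote for the correct decision among those of `2 * k + 1` non-experts,
compared with adding it to the flow of the expert: she is wrong, and `k + 1` of the others vote
for the correct decision. -/
noncomputable def correctionProb (p c w d : ℝ) (k : ℕ) : ℝ :=
  (1 - p) * trinomialMean c w d (2 * k + 1) fun x _ => if x = k + 1 then 1 else 0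

/-- The loss from a single vote for the wrong decision among those of `2 * k + 1` non-experts,
compared with adding it to the flow of the expert: she is right, and `k + 1` of the others vote
for the wrong decision. -/
noncomputable def distortionProb (p c w d : ℝ) (k : ℕ) : ℝ :=
  p * trinomialMean c w d (2 * k + 1) fun _ y => if y = k + 1 then 1 else 0

section Comparison

variable {p c w d : ℝ} {k : ℕ}

theorem winProb_succ_left (p : ℝ) (h x y : ℕ) :
    winProb p h (x + 1) y = winProb p h x y + (1 - p) * if x = h then 1 else 0 := by
  simp only [winProb]
  rcases lt_trichotomy x h with hx | hx | hx
  · simp [hx.ne, hx.not_gt, show ¬ h < x + 1 by omega]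
  · simp [hx]
  · simp [hx.ne', hx, show h < x + 1 by omega]

theorem winProb_succ_right (p : ℝ) (h x y : ℕ) :
    winProb p h x (y + 1) = winProb p h x y - p * if y = h then 1 else 0 := by
  simp only [winProb]
  rcases lt_trichotomy y h with hy | hy | hy
  · simp [hy.ne, hy.le, show y + 1 ≤ h by omega]
  · simp [hy]
  · simp [hy.ne', hy.not_ge, show ¬ y + 1 ≤ h by omega]

theorem trinomialMean_winProb_succ_left :
    trinomialMean c w d (2 * k + 1) (fun x y => winProb p (k + 1) (x + 1) y) =
      trinomialMean c w d (2 * k + 1) (winProb p (k + 1)) + correctionProb p c w d k := by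
  rw [correctionProb, ← trinomialMean_mul_left, ← trinomialMean_add]
  simp only [winProb_succ_left]

theorem trinomialMean_winProb_succ_right :
    trinomialMean c w d (2 * k + 1) (fun x y => winProb p (k + 1) x (y + 1)) =
      trinomialMean c w d (2 * k + 1) (winProb p (k + 1)) - distortionProb p c w d k := by
  rw [distortionProb, ← trinomialMean_mul_left, ← trinomialMean_sub]
  simp only [winProb_succ_right]

/-- If one more vote is pivotal, then exactly `k + 1` of the `2 * k + 1` non-experts vote against
the expert. So a random one of them votes with her or delegates to her only with probability
`k / (2 * k + 1)`. -/
theorem trinomialMean_nonExpert_delegates :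
    trinomialMean c w d (2 * k + 1) (fun x y =>
        (x * winProb p (k + 1) (x + 1) y + y * winProb p (k + 1) x (y + 1) +
          (2 * k + 1 - x - y) * winProb p (k + 1) x y) / (2 * k + 1)) =
      trinomialMean c w d (2 * k + 1) (winProb p (k + 1)) +
        (k + 1) / (2 * k + 1) * (correctionProb p c w d k - distortionProb p c w d k) := by
  rw [correctionProb, distortionProb, ← trinomialMean_mul_left, ← trinomialMean_mul_left,
    ← trinomialMean_sub, ← trinomialMean_mul_left, ← trinomialMean_add]
  congr 1
  ext x y
  have hk : (2 * k + 1 : ℝ) ≠ 0 := by positivity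
  have hx : (x : ℝ) * (if x = k + 1 then 1 else 0) = (k + 1) * if x = k + 1 then 1 else 0 := by
    split_ifs with h <;> simp [h]
  have hy : (y : ℝ) * (if y = k + 1 then 1 else 0) = (k + 1) * if y = k + 1 then 1 else 0 := by
    split_ifs with h <;> simp [h]
  rw [winProb_succ_left, winProb_succ_right]
  field_simp
  linear_combination (1 - p) * hx - p * hy

theorem winProb_shift (hp : 0 ≤ p) (hp1 : p ≤ 1) (h x y : ℕ) :
    winProb p h x (y + 1) ≤ winProb p h (x + 1) y := by
  rw [winProb_succ_left, winProb_succ_right]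
  have h1 : 0 ≤ p * (if y = h then 1 else 0 : ℝ) := by split_ifs <;> simp [hp]
  have h2 : 0 ≤ (1 - p) * (if x = h then 1 else 0 : ℝ) := by split_ifs <;> simp [hp1]
  linarith

theorem hasDerivAt_trinomialMean_winProb {c' w' d' : ℝ} (h : c' + w' + d' = 0) :
    HasDerivAt (fun t : ℝ => trinomialMean (c + t * c') (w + t * w') (d + t * d') (2 * k + 2)
        (winProb p (k + 1)))
      ((2 * k + 2) * (c' * correctionProb p c w d k - w' * distortionProb p c w d k)) 0 := by
  refine (hasDerivAt_trinomialMean c' w' d' (2 * k + 1) (winProb p (k + 1))).congr_deriv ?_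
  rw [trinomialMean_winProb_succ_left, trinomialMean_winProb_succ_right]
  obtain rfl : d' = -c' - w' := by linarith
  push_cast
  ring

theorem distortionProb_pos (hp : 0 < p) (hc : 0 < c) (hw : 0 < w) (hd : 0 ≤ d) :
    0 < distortionProb p c w d k := by
  refine mul_pos hp (lt_of_lt_of_le (b := c ^ k * w ^ (k + 1)) ?_ ?_)
  · positivity
  · have := le_trinomialMean hc.le hw.le hd (f := fun _ y => if y = k + 1 then 1 else 0)
      (fun x y => by split_ifs <;> simp) k (k + 1) 0
    rw [show k + (k + 1) + 0 = 2 * k + 1 by ring] at this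
    simpa using this

theorem correctionProb_pos (hp : p < 1) (hc : 0 < c) (hw : 0 < w) (hd : 0 ≤ d) :
    0 < correctionProb p c w d k := by
  have h := distortionProb_pos (k := k) (sub_pos.2 hp) hw hc hd
  rw [distortionProb, trinomialMean_swap] at h
  exact h

/-- If everybody votes, exactly `k + 1` votes against the expert out of `2 * k + 1` are more
likely when she is right, because she is better informed than a single opponent. -/
theorem correctionProb_lt_distortionProb (hc : 0 < c) (hw : 0 < w)
    (hcw : (1 - p) * c < p * w) : correctionProb p c w 0 k < distortionProb p c w 0 k := by
  have hpos : 0 < distortionProb (p - (1 - p) * c / w) c w 0 k := by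
    refine distortionProb_pos ?_ hc hw le_rfl
    rw [sub_pos, div_lt_iff₀ hw]
    exact hcw
  -- If the odds of the expert were only `c / w`, like those of a voter, then both events would be
  -- equally likely.
  have h : 0 ≤ trinomialMean c w 0 (2 * k + 1) fun x y =>
      (1 - p) * c / w * (if y = k + 1 then 1 else 0) - (1 - p) * if x = k + 1 then 1 else 0 := by
    refine trinomialMean_nonneg_of_symm le_rfl fun x y _ hxy => le_of_eq ?_
    have hxy := hxy rfl
    by_cases hx : x = k + 1
    · obtain rfl : y = k := by omega
      subst hx
      simp
      field_simp
      ring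
    · by_cases hy : y = k + 1
      · obtain rfl : x = k := by omega
        subst hy
        simp
        field_simp
        ring
      · simp [hx, hy]
  rw [trinomialMean_sub, trinomialMean_mul_left, trinomialMean_mul_left] at h
  rw [distortionProb, sub_mul] at hpos
  rw [distortionProb, correctionProb]
  linarith

/-- Voters whose odds of being right, squared, exceed the odds of the expert improve on her: at
least two more of them vote against her than with her whenever she is overruled. -/
theorem lt_trinomialMean_winProb (hw : 0 < w) (hwc : w ≤ c) (hd : 0 ≤ d) (hp1 : p < 1)
    (hsum : c + w + d = 1) (hcw : p * w ^ 2 < (1 - p) * c ^ 2) :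
    p < trinomialMean c w d (2 * k + 2) (winProb p (k + 1)) := by
  have hc : 0 < c := hw.trans_le hwc
  set r := (1 - p) * c ^ 2 / w ^ 2 with hr
  have hpr : p < r := by rw [hr, lt_div_iff₀ (by positivity)]; exact hcw
  have hrw : r * w ^ 2 = (1 - p) * c ^ 2 := by rw [hr]; field_simp
  have h : 0 ≤ trinomialMean c w d (2 * k + 2) fun x y =>
      (1 - p) * (if k + 1 < x then 1 else 0) - r * if k + 1 < y then 1 else 0 := by
    have key (x y : ℕ) (h : k + 1 < x) (hxy : x + y ≤ 2 * k + 2) :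
        r * (c ^ y * w ^ x) ≤ (1 - p) * (c ^ x * w ^ y) := by
      obtain ⟨m, rfl⟩ : ∃ m, x = y + 2 + m := ⟨x - y - 2, by omega⟩
      have h1 : r * (c ^ y * w ^ (y + 2 + m)) = (1 - p) * c ^ (y + 2) * w ^ y * w ^ m := by
        linear_combination c ^ y * w ^ y * w ^ m * hrw
      rw [h1, show (1 - p) * (c ^ (y + 2 + m) * w ^ y) = (1 - p) * c ^ (y + 2) * w ^ y * c ^ m by
        ring]
      have : 0 ≤ 1 - p := by linarith
      gcongr
    refine trinomialMean_nonneg_of_symm hd fun x y hxy _ => ?_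
    by_cases hx : k + 1 < x
    · have := key x y hx hxy
      simp [hx, show ¬ k + 1 < y by omega]
      linarith
    · by_cases hy : k + 1 < y
      · have := key y x hy (by omega)
        simp [hx, hy]
        linarith
      · simp [hx, hy]
  have hpos : 0 < trinomialMean c w d (2 * k + 2) fun _ y => if k + 1 < y then 1 else 0 := by
    have := le_trinomialMean hc.le hw.le hd (f := fun _ y => if k + 1 < y then 1 else 0)
      (fun x y => by split_ifs <;> simp) 0 (2 * k + 2) 0
    rw [show 0 + (2 * k + 2) + 0 = 2 * k + 2 by ring, if_pos (by omega)] at this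
    exact lt_of_lt_of_le (by positivity) this
  have hdecomp : trinomialMean c w d (2 * k + 2) (winProb p (k + 1)) =
      p + (trinomialMean c w d (2 * k + 2) (fun x y =>
        (1 - p) * (if k + 1 < x then 1 else 0) - r * if k + 1 < y then 1 else 0) +
      (r - p) * trinomialMean c w d (2 * k + 2) fun _ y => if k + 1 < y then 1 else 0) := by
    rw [← trinomialMean_mul_left, ← trinomialMean_add]
    nth_rw 2 [← trinomialMean_const hsum (2 * k + 2) p]
    rw [← trinomialMean_add]
    congr 1
    ext x y
    simp only [winProb, ← not_lt, ite_not]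
    split_ifs <;> ring
  rw [hdecomp]
  have := mul_pos (sub_pos.2 hpr) hpos
  linarith

theorem trinomialMean_zero_zero_pos (hc : 0 ≤ c) (hw : 0 ≤ w) (hd : 0 < d) (n : ℕ) :
    0 < trinomialMean c w d n fun x y => if x + y = 0 then 1 else 0 := by
  have := le_trinomialMean hc hw hd.le (f := fun x y => if x + y = 0 then 1 else 0)
    (fun x y => by split_ifs <;> simp) 0 0 n
  rw [show 0 + 0 + n = n by ring, if_pos rfl] at this
  exact lt_of_lt_of_le (by positivity) this

theorem trinomialMean_expert_vote_not_lt (hc : 0 ≤ c) (hw : 0 ≤ w) (hd : 0 < d) (hp : 1 / 2 < p) :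
    trinomialMean c w d (2 * k + 2) (winProb (1 - p) (k + 1)) <
      trinomialMean c w d (2 * k + 2) (winProb p (k + 1)) := by
  have h := trinomialMean_zero_zero_pos hc hw hd (2 * k + 2)
  have h1 : trinomialMean c w d (2 * k + 2) (fun x y => winProb (1 - p) (k + 1) x y +
      (2 * p - 1) * if x + y = 0 then 1 else 0) ≤
        trinomialMean c w d (2 * k + 2) (winProb p (k + 1)) := by
    refine trinomialMean_mono hc hw hd.le fun x y hxy _ => ?_
    simp only [winProb]
    split_ifs <;> linarith
  rw [trinomialMean_add, trinomialMean_mul_left] at h1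
  have := mul_pos (show 0 < 2 * p - 1 by linarith) h
  linarith

/-- The expert is better informed than a random voter among the non-experts, even if only the
cases in which the delegated votes are pivotal are taken into account. -/
theorem trinomialMean_expert_delegates_lt (hw : 0 ≤ w) (hwc : w ≤ c) (hd : 0 < d)
    (hp : 1 / 2 < p) (hcw : (1 - p) * c ≤ p * w) :
    trinomialMean c w d (2 * k + 2) (delegatedWinProb (k + 1)) <
      trinomialMean c w d (2 * k + 2) (winProb p (k + 1)) := by
  have hc : 0 ≤ c := hw.trans hwc
  set h : ℕ → ℕ → ℝ := fun x y => if x ≤ k + 1 ∧ y ≤ k + 1 then 1 / (x + y) else 0 with hh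
  -- `h` picks the cases in which the votes of the expert are pivotal. The last term stems from the
  -- coin that is tossed if nobody votes.
  have hdecomp : trinomialMean c w d (2 * k + 2) (winProb p (k + 1)) =
      trinomialMean c w d (2 * k + 2) (delegatedWinProb (k + 1)) +
      ((p * trinomialMean c w d (2 * k + 1 + 1) (fun x y => y * h x y) -
        (1 - p) * trinomialMean c w d (2 * k + 1 + 1) (fun x y => x * h x y)) +
      (p - 1 / 2) * trinomialMean c w d (2 * k + 2) fun x y => if x + y = 0 then 1 else 0) := by
    rw [← trinomialMean_mul_left, ← trinomialMean_mul_left, ← trinomialMean_mul_left,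
      ← trinomialMean_sub, ← trinomialMean_add, ← trinomialMean_add]
    refine trinomialMean_congr hc hw hd.le fun x y hxy => ?_
    by_cases h0 : x + y = 0
    · obtain ⟨rfl, rfl⟩ : x = 0 ∧ y = 0 := by omega
      simp [winProb, delegatedWinProb]
    · have h0' : (x + y : ℝ) ≠ 0 := by exact_mod_cast h0
      simp only [winProb, delegatedWinProb, if_neg h0, hh]
      by_cases hx : x ≤ k + 1
      · by_cases hy : y ≤ k + 1
        · simp [hx, hy, show ¬ k + 1 < x by omega]
          field_simp
          ring
        · simp [hy, show ¬ k + 1 < x by omega]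
      · simp [hx, show k + 1 < x by omega, show y ≤ k + 1 by omega, h0']
  -- For `x ≤ y` the difference is nonzero only if `x < y = k + 1`. It is then negative at `(x, y)`
  -- and positive at `(y, x)`, which has more correct votes and is at least as likely.
  have hcomp : 0 ≤ trinomialMean c w d (2 * k + 1) fun x y => h x (y + 1) - h (x + 1) y := by
    have hcongr (x y : ℕ) : h x (y + 1) - h (x + 1) y =
        ((if x ≤ k + 1 ∧ y ≤ k then 1 else 0) - (if x ≤ k ∧ y ≤ k + 1 then 1 else 0)) /
          (x + y + 1) := by
      simp only [hh, add_le_add_iff_right]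
      push_cast
      rw [sub_div, add_right_comm (x : ℝ) 1 y, ← add_assoc]
      congr 1 <;> split_ifs <;> simp
    refine trinomialMean_nonneg_of_symm hd.le fun x y _ _ => ?_
    have hpow {m n : ℕ} (hmn : m ≤ n) : 0 ≤ c ^ n * w ^ m - c ^ m * w ^ n := by
      obtain ⟨j, rfl⟩ := Nat.exists_eq_add_of_le hmn
      rw [pow_add, pow_add, show c ^ m * c ^ j * w ^ m - c ^ m * (w ^ m * w ^ j) =
        c ^ m * w ^ m * (c ^ j - w ^ j) by ring]
      have := pow_le_pow_left₀ hw hwc j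
      exact mul_nonneg (by positivity) (by linarith)
    rw [hcongr, hcongr, show (y + x + 1 : ℝ) = x + y + 1 by ring,
      show (if y ≤ k + 1 ∧ x ≤ k then (1 : ℝ) else 0) = if x ≤ k ∧ y ≤ k + 1 then 1 else 0 by
        simp only [and_comm],
      show (if y ≤ k ∧ x ≤ k + 1 then (1 : ℝ) else 0) = if x ≤ k + 1 ∧ y ≤ k then 1 else 0 by
        simp only [and_comm],
      mul_div_assoc', mul_div_assoc', ← add_div]
    refine div_nonneg ?_ (by positivity)
    rcases le_total y x with hxy | hxy
    · have := hpow hxy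
      split_ifs <;> first | linarith | omega
    · have := hpow hxy
      split_ifs <;> first | linarith | omega
  have hnn : 0 ≤ trinomialMean c w d (2 * k + 1) fun x y => h (x + 1) y :=
    trinomialMean_nonneg hc hw hd.le fun x y _ _ => by
      simp only [hh]
      split_ifs <;> positivity
  rw [trinomialMean_sub] at hcomp
  rw [hdecomp, trinomialMean_fst_mul, trinomialMean_snd_mul]
  have h1 := mul_pos (show 0 < p - 1 / 2 by linarith)
    (trinomialMean_zero_zero_pos hc hw hd (2 * k + 2))
  have h2 := mul_le_mul_of_nonneg_left (sub_nonneg.1 hcomp) (mul_nonneg (by linarith : 0 ≤ p) hw)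
  have h3 := mul_le_mul_of_nonneg_right hcw hnn
  have h4 := mul_le_mul_of_nonneg_left (h3.trans h2)
    (show (0 : ℝ) ≤ ((2 * k + 1 : ℕ) : ℝ) + 1 by positivity)
  linarith

end Comparison

/-! ### Optimal participation -/

/-- The probability `v q` with which a non-expert of precision `q` votes. -/
structure IsVotingRule (p : ℝ) (v : ℝ → ℝ) : Prop where
  measurable : Measurable v
  mem_Icc : ∀ q ∈ Set.Icc (1 / 2) p, v q ∈ Set.Icc 0 1

/-- The probability that a non-expert casts a correct vote under the voting rule `v`. -/
noncomputable def correctRate (μ : Measure ℝ) (v : ℝ → ℝ) : ℝ := ∫ q, q * v q ∂μ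

/-- The probability that a non-expert casts a wrong vote under the voting rule `v`. -/
noncomputable def wrongRate (μ : Measure ℝ) (v : ℝ → ℝ) : ℝ := ∫ q, (1 - q) * v q ∂μ

/-- The voting rule of those who vote if their precision is at least `t`. -/
noncomputable def thresholdRule (t q : ℝ) : ℝ := if q < t then 0 else 1

/-- The probability of a correct decision if the expert votes and `2 * k + 2` non-experts follow
the voting rule `v` and delegate to her otherwise. -/
noncomputable def groupWinProb (μ : Measure ℝ) (p : ℝ) (k : ℕ) (v : ℝ → ℝ) : ℝ :=
  trinomialMean (correctRate μ v) (wrongRate μ v) (1 - correctRate μ v - wrongRate μ v)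
    (2 * k + 2) (winProb p (k + 1))

section Rates

variable {μ : Measure ℝ} {p : ℝ} {v : ℝ → ℝ}

theorem isVotingRule_thresholdRule (p t : ℝ) : IsVotingRule p (thresholdRule t) where
  measurable := Measurable.ite measurableSet_Iio measurable_const measurable_const
  mem_Icc q _ := by
    rw [thresholdRule]
    split_ifs <;> simp

theorem ae_mem_Icc (hμ : μ.support = Set.Icc (1 / 2) p) : ∀ᵐ q ∂μ, q ∈ Set.Icc (1 / 2) p := by
  rw [← hμ]
  exact Measure.support_mem_ae

theorem measure_Ioo_pos (hμ : μ.support = Set.Icc (1 / 2) p) {a b : ℝ} (hab : a < b)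
    (ha : 1 / 2 ≤ a) (hb : b ≤ p) : 0 < μ (Set.Ioo a b) := by
  have h : (a + b) / 2 ∈ μ.support := by
    rw [hμ]
    constructor <;> linarith
  exact (Measure.mem_support_iff_forall _).1 h _ (Ioo_mem_nhds (by linarith) (by linarith))

/-- The integral of a function that is positive on an interval of possible precisions. -/
theorem integral_pos_of_Ioo (hμ : μ.support = Set.Icc (1 / 2) p) {f : ℝ → ℝ}
    (hf : Integrable f μ) (h0 : ∀ q ∈ Set.Icc (1 / 2) p, 0 ≤ f q) {a b : ℝ} (hab : a < b)
    (ha : 1 / 2 ≤ a) (hb : b ≤ p) (hpos : ∀ q ∈ Set.Ioo a b, 0 < f q) : 0 < ∫ q, f q ∂μ := by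
  rw [integral_pos_iff_support_of_nonneg_ae ((ae_mem_Icc hμ).mono fun q hq => h0 q hq) hf]
  exact (measure_Ioo_pos hμ hab ha hb).trans_le
    (measure_mono fun q hq => (hpos q hq).ne')

theorem thresholdRule_half_ae (hμ : μ.support = Set.Icc (1 / 2) p) :
    thresholdRule (1 / 2) =ᵐ[μ] fun _ => 1 := by
  filter_upwards [ae_mem_Icc hμ] with q hq
  rw [thresholdRule, if_neg hq.1.not_gt]

theorem thresholdRule_top_ae [NullSingletonClass μ] (hμ : μ.support = Set.Icc (1 / 2) p) :
    thresholdRule p =ᵐ[μ] fun _ => 0 := by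
  have hne : ∀ᵐ q ∂μ, q ≠ p := by simp [ae_iff]
  filter_upwards [ae_mem_Icc hμ, hne] with q hq hqp
  simp [thresholdRule, lt_of_le_of_ne hq.2 hqp]

variable [IsProbabilityMeasure μ]

theorem integrable_of_abs_le_one (hμ : μ.support = Set.Icc (1 / 2) p) {f : ℝ → ℝ}
    (hf : Measurable f) (h : ∀ q ∈ Set.Icc (1 / 2) p, |f q| ≤ 1) : Integrable f μ :=
  Integrable.of_bound hf.aestronglyMeasurable 1 ((ae_mem_Icc hμ).mono fun q hq => h q hq)

theorem IsVotingRule.integrable (hv : IsVotingRule p v) (hμ : μ.support = Set.Icc (1 / 2) p) :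
    Integrable v μ :=
  integrable_of_abs_le_one hμ hv.measurable fun q hq => by
    have := hv.mem_Icc q hq
    rw [abs_of_nonneg this.1]
    exact this.2

theorem IsVotingRule.integrable_mul (hv : IsVotingRule p v) (hp1 : p < 1)
    (hμ : μ.support = Set.Icc (1 / 2) p) : Integrable (fun q => q * v q) μ :=
  integrable_of_abs_le_one hμ (measurable_id.mul hv.measurable) fun q hq => by
    have h := hv.mem_Icc q hq
    have h0 : 0 ≤ q := by linarith [hq.1]
    rw [abs_of_nonneg (mul_nonneg h0 h.1)]
    exact mul_le_one₀ (by linarith [hq.2]) h.1 h.2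

theorem IsVotingRule.integrable_one_sub_mul (hv : IsVotingRule p v) (hp1 : p < 1)
    (hμ : μ.support = Set.Icc (1 / 2) p) : Integrable (fun q => (1 - q) * v q) μ := by
  refine ((hv.integrable hμ).sub (hv.integrable_mul hp1 hμ)).congr (ae_of_all _ fun q => ?_)
  simp only [Pi.sub_apply]
  ring

theorem IsVotingRule.linear_rates (hv : IsVotingRule p v) (hp1 : p < 1)
    (hμ : μ.support = Set.Icc (1 / 2) p) (a b : ℝ) :
    a * correctRate μ v + b * wrongRate μ v = ∫ q, (a * q + b * (1 - q)) * v q ∂μ := by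
  rw [correctRate, wrongRate, ← integral_const_mul, ← integral_const_mul, ← integral_add
    ((hv.integrable_mul hp1 hμ).const_mul a) ((hv.integrable_one_sub_mul hp1 hμ).const_mul b)]
  congr 1
  ext q
  ring

theorem IsVotingRule.integrable_linear (hv : IsVotingRule p v) (hp1 : p < 1)
    (hμ : μ.support = Set.Icc (1 / 2) p) (a b : ℝ) :
    Integrable (fun q => (a * q + b * (1 - q)) * v q) μ := by
  refine (((hv.integrable_mul hp1 hμ).const_mul a).add
    ((hv.integrable_one_sub_mul hp1 hμ).const_mul b)).congr (ae_of_all _ fun q => ?_)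
  simp only [Pi.add_apply]
  ring

theorem IsVotingRule.rates_add (hv : IsVotingRule p v) (hp1 : p < 1)
    (hμ : μ.support = Set.Icc (1 / 2) p) : correctRate μ v + wrongRate μ v = ∫ q, v q ∂μ := by
  simpa using hv.linear_rates hp1 hμ 1 1

theorem IsVotingRule.rates_nonneg (hv : IsVotingRule p v) (hp1 : p < 1)
    (hμ : μ.support = Set.Icc (1 / 2) p) {a b : ℝ}
    (h : ∀ q ∈ Set.Icc (1 / 2) p, 0 ≤ a * q + b * (1 - q)) :
    0 ≤ a * correctRate μ v + b * wrongRate μ v := by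
  rw [hv.linear_rates hp1 hμ]
  exact integral_nonneg_of_ae ((ae_mem_Icc hμ).mono fun q hq =>
    mul_nonneg (h q hq) (hv.mem_Icc q hq).1)

theorem thresholdRule_rates_pos {t : ℝ} (ht : t ∈ Set.Ico (1 / 2) p) (hp1 : p < 1)
    (hμ : μ.support = Set.Icc (1 / 2) p) {a b : ℝ}
    (h : ∀ q ∈ Set.Icc t p, 0 ≤ a * q + b * (1 - q))
    (hpos : ∀ q ∈ Set.Ioo t p, 0 < a * q + b * (1 - q)) :
    0 < a * correctRate μ (thresholdRule t) + b * wrongRate μ (thresholdRule t) := by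
  have hv := isVotingRule_thresholdRule p t
  rw [hv.linear_rates hp1 hμ]
  refine integral_pos_of_Ioo hμ (hv.integrable_linear hp1 hμ a b) (fun q hq => ?_) ht.2 ht.1 le_rfl
    fun q hq => ?_
  · rw [thresholdRule]
    split_ifs with hqt
    · simp
    · simpa using h q ⟨not_lt.1 hqt, hq.2⟩
  · rw [thresholdRule, if_neg hq.1.not_gt, mul_one]
    exact hpos q hq

theorem IsVotingRule.correctRate_nonneg (hv : IsVotingRule p v) (hp1 : p < 1)
    (hμ : μ.support = Set.Icc (1 / 2) p) : 0 ≤ correctRate μ v := by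
  simpa using hv.rates_nonneg hp1 hμ (a := 1) (b := 0) fun q hq => by linarith [hq.1]

theorem IsVotingRule.wrongRate_nonneg (hv : IsVotingRule p v) (hp1 : p < 1)
    (hμ : μ.support = Set.Icc (1 / 2) p) : 0 ≤ wrongRate μ v := by
  simpa using hv.rates_nonneg hp1 hμ (a := 0) (b := 1) fun q hq => by linarith [hq.2]

theorem IsVotingRule.rates_add_le_one (hv : IsVotingRule p v) (hp1 : p < 1)
    (hμ : μ.support = Set.Icc (1 / 2) p) : correctRate μ v + wrongRate μ v ≤ 1 := by
  rw [hv.rates_add hp1 hμ]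
  calc ∫ q, v q ∂μ ≤ ∫ _, (1 : ℝ) ∂μ :=
        integral_mono_ae (hv.integrable hμ) (integrable_const _)
          ((ae_mem_Icc hμ).mono fun q hq => (hv.mem_Icc q hq).2)
    _ = 1 := by simp

/-- A continuous distribution function has no atoms. -/
theorem nullSingletonClass_of_continuous_cdf (h : Continuous (cdf μ)) : NullSingletonClass μ where
  measure_singleton a := by
    conv_lhs => rw [← measure_cdf μ]
    rw [StieltjesFunction.measure_singleton, h.continuousWithinAt.leftLim_eq, sub_self,
      ENNReal.ofReal_zero]

variable [NullSingletonClass μ]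

theorem continuous_integral_thresholdRule (hμ : μ.support = Set.Icc (1 / 2) p) {f : ℝ → ℝ}
    (hf : Measurable f) (h : ∀ q ∈ Set.Icc (1 / 2) p, |f q| ≤ 1) :
    Continuous fun t => ∫ q, f q * thresholdRule t q ∂μ := by
  rw [continuous_iff_continuousAt]
  intro t₀
  refine continuousAt_of_dominated (bound := fun _ => 1)
    (.of_forall fun t => (hf.mul (isVotingRule_thresholdRule p t).measurable).aestronglyMeasurable)
    (.of_forall fun t => (ae_mem_Icc hμ).mono fun q hq => ?_) (integrable_const _) ?_
  · rw [thresholdRule]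
    split_ifs
    · simp
    · simpa using h q hq
  · have hne : ∀ᵐ q ∂μ, q ≠ t₀ := by simp [ae_iff]
    filter_upwards [hne] with q hq
    refine continuousAt_const.mul ?_
    rcases hq.lt_or_gt with hq | hq
    · refine (continuousAt_const (y := (0 : ℝ))).congr ?_
      filter_upwards [eventually_gt_nhds hq] with t ht
      simp [thresholdRule, ht]
    · refine (continuousAt_const (y := (1 : ℝ))).congr ?_
      filter_upwards [eventually_lt_nhds hq] with t ht
      simp [thresholdRule, ht.not_gt]

theorem continuous_correctRate (hμ : μ.support = Set.Icc (1 / 2) p) (hp1 : p < 1) :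
    Continuous fun t => correctRate μ (thresholdRule t) :=
  continuous_integral_thresholdRule hμ measurable_id' fun q hq => by
    rw [abs_of_nonneg] <;> linarith [hq.1, hq.2]

theorem continuous_wrongRate (hμ : μ.support = Set.Icc (1 / 2) p) (hp1 : p < 1) :
    Continuous fun t => wrongRate μ (thresholdRule t) :=
  continuous_integral_thresholdRule hμ (measurable_const.sub measurable_id') fun q hq => by
    rw [abs_of_nonneg] <;> linarith [hq.1, hq.2]

/-- For a given turnout, the votes are best if the best informed vote. -/
theorem IsVotingRule.exists_thresholdRule (hv : IsVotingRule p v) (hp : 1 / 2 < p) (hp1 : p < 1)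
    (hμ : μ.support = Set.Icc (1 / 2) p) :
    ∃ t ∈ Set.Icc (1 / 2) p, correctRate μ v ≤ correctRate μ (thresholdRule t) ∧
      correctRate μ (thresholdRule t) + wrongRate μ (thresholdRule t) =
        correctRate μ v + wrongRate μ v := by
  have hcont : Continuous fun t => ∫ q, thresholdRule t q ∂μ := by
    simpa using continuous_integral_thresholdRule hμ (f := fun _ => 1) measurable_const (by simp)
  obtain ⟨t, ht, hvt⟩ : ∃ t ∈ Set.Icc (1 / 2) p, ∫ q, thresholdRule t q ∂μ = ∫ q, v q ∂μ := by
    refine intermediate_value_Icc' hp.le hcont.continuousOn ⟨?_, ?_⟩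
    · rw [integral_congr_ae (thresholdRule_top_ae hμ), integral_zero]
      exact integral_nonneg_of_ae ((ae_mem_Icc hμ).mono fun q hq => (hv.mem_Icc q hq).1)
    · rw [integral_congr_ae (thresholdRule_half_ae hμ), ← hv.rates_add hp1 hμ]
      simpa using hv.rates_add_le_one hp1 hμ
  have hvt' := isVotingRule_thresholdRule p t
  refine ⟨t, ht, ?_, by rw [hvt'.rates_add hp1 hμ, hv.rates_add hp1 hμ, hvt]⟩
  have h : 0 ≤ ∫ q, (q * thresholdRule t q - q * v q) - t * (thresholdRule t q - v q) ∂μ := by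
    refine integral_nonneg_of_ae ((ae_mem_Icc hμ).mono fun q hq => ?_)
    have h1 := hv.mem_Icc q hq
    have h2 : (q * thresholdRule t q - q * v q) - t * (thresholdRule t q - v q) =
        (q - t) * (thresholdRule t q - v q) := by ring
    simp only [Pi.zero_apply]
    rw [h2, thresholdRule]
    split_ifs with hqt
    · exact mul_nonneg_of_nonpos_of_nonpos (by linarith) (by linarith [h1.1])
    · exact mul_nonneg (by linarith) (by linarith [h1.2])
  have hi1 : Integrable (fun q => q * thresholdRule t q - q * v q) μ :=
    (hvt'.integrable_mul hp1 hμ).sub (hv.integrable_mul hp1 hμ)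
  have hi2 : Integrable (fun q => t * (thresholdRule t q - v q)) μ :=
    ((hvt'.integrable hμ).sub (hv.integrable hμ)).const_mul t
  rw [integral_sub hi1 hi2,
    integral_sub (hvt'.integrable_mul hp1 hμ) (hv.integrable_mul hp1 hμ), integral_const_mul,
    integral_sub (hvt'.integrable hμ) (hv.integrable hμ), hvt, sub_self, mul_zero, sub_zero] at h
  exact sub_nonneg.1 h

end Rates

section Optimum

variable {μ : Measure ℝ} {p : ℝ} {k : ℕ} {v : ℝ → ℝ}

theorem groupWinProb_congr {v' : ℝ → ℝ} (h : v =ᵐ[μ] v') :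
    groupWinProb μ p k v = groupWinProb μ p k v' := by
  have h1 : correctRate μ v = correctRate μ v' :=
    integral_congr_ae (h.mono fun q hq => by simp only [hq])
  have h2 : wrongRate μ v = wrongRate μ v' :=
    integral_congr_ae (h.mono fun q hq => by simp only [hq])
  rw [groupWinProb, h1, h2, groupWinProb]

variable [IsProbabilityMeasure μ]

/-- If no voting rule is better than `v`, then a change of the rule of a single voter does not
help either. -/
theorem IsVotingRule.first_order (hv : IsVotingRule p v) (hp1 : p < 1)
    (hμ : μ.support = Set.Icc (1 / 2) p)
    (hmax : ∀ u, IsVotingRule p u → groupWinProb μ p k u ≤ groupWinProb μ p k v) {c w d : ℝ}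
    (hc : correctRate μ v = c) (hw : wrongRate μ v = w) (hd : 1 - c - w = d) {u : ℝ → ℝ}
    (hu : IsVotingRule p u) :
    (correctRate μ u - c) * correctionProb p c w d k ≤
      (wrongRate μ u - w) * distortionProb p c w d k := by
  have hder := hasDerivAt_trinomialMean_winProb (p := p) (c := c) (w := w) (d := d) (k := k)
    (show (correctRate μ u - c) + (wrongRate μ u - w) +
      -((correctRate μ u - c) + (wrongRate μ u - w)) = 0 by ring)
  have hle (s : ℝ) (hs : s ∈ Set.Icc (0 : ℝ) 1) :
      trinomialMean (c + s * (correctRate μ u - c)) (w + s * (wrongRate μ u - w))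
        (d + s * -((correctRate μ u - c) + (wrongRate μ u - w))) (2 * k + 2) (winProb p (k + 1)) ≤
      trinomialMean c w d (2 * k + 2) (winProb p (k + 1)) := by
    have hmix : IsVotingRule p fun q => (1 - s) * v q + s * u q := by
      refine ⟨(hv.measurable.const_mul _).add (hu.measurable.const_mul _), fun q hq => ?_⟩
      have h := (convex_Icc (0 : ℝ) 1) (hv.mem_Icc q hq) (hu.mem_Icc q hq)
        (sub_nonneg.2 hs.2) hs.1 (by ring)
      simpa using h
    have hcr : correctRate μ (fun q => (1 - s) * v q + s * u q) =
        c + s * (correctRate μ u - c) := by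
      have h : correctRate μ (fun q => (1 - s) * v q + s * u q) =
          (1 - s) * correctRate μ v + s * correctRate μ u := by
        simp only [correctRate]
        rw [← integral_const_mul, ← integral_const_mul, ← integral_add
          ((hv.integrable_mul hp1 hμ).const_mul _) ((hu.integrable_mul hp1 hμ).const_mul _)]
        congr 1
        ext q
        ring
      rw [h, hc]
      ring
    have hwr : wrongRate μ (fun q => (1 - s) * v q + s * u q) =
        w + s * (wrongRate μ u - w) := by
      have h : wrongRate μ (fun q => (1 - s) * v q + s * u q) =
          (1 - s) * wrongRate μ v + s * wrongRate μ u := by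
        simp only [wrongRate]
        rw [← integral_const_mul, ← integral_const_mul, ← integral_add
          ((hv.integrable_one_sub_mul hp1 hμ).const_mul _)
          ((hu.integrable_one_sub_mul hp1 hμ).const_mul _)]
        congr 1
        ext q
        ring
      rw [h, hw]
      ring
    have h := hmax _ hmix
    rw [groupWinProb, groupWinProb, hcr, hwr, hc, hw, hd] at h
    refine le_trans (le_of_eq ?_) h
    congr 1
    rw [← hd]
    ring
  have hslope := hder.tendsto_slope_zero_right
  have hnonpos := le_of_tendsto hslope (b := 0) (by
    filter_upwards [Ioo_mem_nhdsGT (zero_lt_one' ℝ)] with s hs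
    have h := hle s ⟨hs.1.le, hs.2.le⟩
    rw [smul_eq_mul]
    refine mul_nonpos_of_nonneg_of_nonpos (inv_nonneg.2 hs.1.le) ?_
    simpa using h)
  have hk : (0 : ℝ) < 2 * k + 2 := by positivity
  have := nonpos_of_mul_nonpos_right hnonpos hk
  linarith

/-- An optimal threshold below the precision of the expert is at least the precision at which a
voter is indifferent. -/
theorem distortionProb_le_of_optimal (hp1 : p < 1) (hμ : μ.support = Set.Icc (1 / 2) p)
    {t c w d : ℝ} (ht : t ∈ Set.Ico (1 / 2) p)
    (hmax : ∀ v, IsVotingRule p v →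
      groupWinProb μ p k v ≤ groupWinProb μ p k (thresholdRule t))
    (hc : correctRate μ (thresholdRule t) = c) (hw : wrongRate μ (thresholdRule t) = w)
    (hd : 1 - c - w = d) (hpos : 0 < correctionProb p c w d k + distortionProb p c w d k) :
    distortionProb p c w d k ≤ (correctionProb p c w d k + distortionProb p c w d k) * t := by
  set β := correctionProb p c w d k
  set α := distortionProb p c w d k
  by_contra! hlt
  -- Otherwise the types between `t` and the point of indifference had better delegate.
  set s := min p (α / (β + α)) with hs
  have hts : t < s := lt_min ht.2 (by rwa [lt_div_iff₀ hpos, mul_comm])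
  have hu := isVotingRule_thresholdRule p s
  have hv := isVotingRule_thresholdRule p t
  have hfo := hv.first_order hp1 hμ hmax hc hw hd hu
  have hint : 0 < ∫ q, (β * q + -α * (1 - q)) * thresholdRule s q -
      (β * q + -α * (1 - q)) * thresholdRule t q ∂μ := by
    have key (q : ℝ) : (β * q + -α * (1 - q)) * thresholdRule s q -
        (β * q + -α * (1 - q)) * thresholdRule t q =
        if t ≤ q ∧ q < s then α - (β + α) * q else 0 := by
      rw [thresholdRule, thresholdRule]
      split_ifs <;> first | ring1 | (exfalso; grind)
    have hq (q : ℝ) (hq : q < s) : 0 < α - (β + α) * q := by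
      have : q < α / (β + α) := hq.trans_le (min_le_right _ _)
      rw [lt_div_iff₀ hpos] at this
      linarith
    refine integral_pos_of_Ioo hμ ((hu.integrable_linear hp1 hμ _ _).sub
      (hv.integrable_linear hp1 hμ _ _)) (fun q _ => ?_) hts ht.1 (min_le_left _ _) fun q hq' => ?_
    · rw [key]
      split_ifs with h
      · exact (hq q h.2).le
      · exact le_rfl
    · rw [key, if_pos ⟨hq'.1.le, hq'.2⟩]
      exact hq q hq'.2
  rw [integral_sub (hu.integrable_linear hp1 hμ _ _) (hv.integrable_linear hp1 hμ _ _),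
    ← hu.linear_rates hp1 hμ, ← hv.linear_rates hp1 hμ, hc, hw] at hint
  linarith

/-- An optimal threshold above the lowest precision is at most the precision at which a voter is
indifferent. -/
theorem le_distortionProb_of_optimal (hp1 : p < 1) (hμ : μ.support = Set.Icc (1 / 2) p)
    {t c w d : ℝ} (ht : t ∈ Set.Ioc (1 / 2) p)
    (hmax : ∀ v, IsVotingRule p v →
      groupWinProb μ p k v ≤ groupWinProb μ p k (thresholdRule t))
    (hc : correctRate μ (thresholdRule t) = c) (hw : wrongRate μ (thresholdRule t) = w)
    (hd : 1 - c - w = d) (hpos : 0 < correctionProb p c w d k + distortionProb p c w d k) :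
    (correctionProb p c w d k + distortionProb p c w d k) * t ≤ distortionProb p c w d k := by
  set β := correctionProb p c w d k
  set α := distortionProb p c w d k
  by_contra! hlt
  -- Otherwise the types between the point of indifference and `t` had better vote.
  set s := max (1 / 2) (α / (β + α)) with hs
  have hts : s < t := max_lt ht.1 (by rwa [div_lt_iff₀ hpos, mul_comm])
  have hu := isVotingRule_thresholdRule p s
  have hv := isVotingRule_thresholdRule p t
  have hfo := hv.first_order hp1 hμ hmax hc hw hd hu
  have hint : 0 < ∫ q, (β * q + -α * (1 - q)) * thresholdRule s q -
      (β * q + -α * (1 - q)) * thresholdRule t q ∂μ := by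
    have key (q : ℝ) : (β * q + -α * (1 - q)) * thresholdRule s q -
        (β * q + -α * (1 - q)) * thresholdRule t q =
        if s ≤ q ∧ q < t then (β + α) * q - α else 0 := by
      rw [thresholdRule, thresholdRule]
      split_ifs <;> first | ring1 | (exfalso; grind)
    have hq {q : ℝ} (hq : s ≤ q) : α ≤ (β + α) * q := by
      have : α / (β + α) ≤ q := (le_max_right _ _).trans hq
      rw [div_le_iff₀ hpos] at this
      linarith
    refine integral_pos_of_Ioo hμ ((hu.integrable_linear hp1 hμ _ _).sub
      (hv.integrable_linear hp1 hμ _ _)) (fun q _ => ?_) hts (le_max_left _ _) ht.2 fun q hq' => ?_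
    · rw [key]
      split_ifs with h
      · exact sub_nonneg.2 (hq h.1)
      · exact le_rfl
    · rw [key, if_pos ⟨hq'.1.le, hq'.2⟩]
      have h1 := hq le_rfl
      have h2 := mul_lt_mul_of_pos_left hq'.1 hpos
      linarith
  rw [integral_sub (hu.integrable_linear hp1 hμ _ _) (hv.integrable_linear hp1 hμ _ _),
    ← hu.linear_rates hp1 hμ, ← hv.linear_rates hp1 hμ, hc, hw] at hint
  linarith

variable [NullSingletonClass μ]

/-- There is an optimal threshold. -/
theorem exists_optimal_thresholdRule (hp : 1 / 2 < p) (hp1 : p < 1)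
    (hμ : μ.support = Set.Icc (1 / 2) p) (k : ℕ) :
    ∃ t ∈ Set.Icc (1 / 2) p, ∀ v, IsVotingRule p v →
      groupWinProb μ p k v ≤ groupWinProb μ p k (thresholdRule t) := by
  have hcont : Continuous fun t => groupWinProb μ p k (thresholdRule t) := by
    have h1 := continuous_correctRate hμ hp1
    have h2 := continuous_wrongRate hμ hp1
    exact (continuous_trinomialMean (2 * k + 2) (winProb p (k + 1))).comp
      (h1.prodMk (h2.prodMk ((continuous_const.sub h1).sub h2)))
  obtain ⟨t, ht, hmax⟩ := isCompact_Icc.exists_isMaxOn ⟨p, hp.le, le_rfl⟩ hcont.continuousOn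
  refine ⟨t, ht, fun v hv => ?_⟩
  obtain ⟨s, hs, hsc, hsum⟩ := hv.exists_thresholdRule hp hp1 hμ
  refine le_trans ?_ (hmax hs)
  simp only [groupWinProb]
  rw [show 1 - correctRate μ (thresholdRule s) - wrongRate μ (thresholdRule s) =
    1 - correctRate μ v - wrongRate μ v by linarith]
  exact trinomialMean_le_of_shift (hv.correctRate_nonneg hp1 hμ)
    ((isVotingRule_thresholdRule p s).wrongRate_nonneg hp1 hμ)
    (by linarith [hv.rates_add_le_one hp1 hμ]) hsc hsum _
    (winProb_shift (by linarith) hp1.le _)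

/-- A few votes by the best informed non-experts are better than no votes. -/
theorem exists_groupWinProb_gt (hp : 1 / 2 < p) (hp1 : p < 1)
    (hμ : μ.support = Set.Icc (1 / 2) p) (k : ℕ) :
    ∃ t, groupWinProb μ p k (thresholdRule p) < groupWinProb μ p k (thresholdRule t) := by
  have hnone : groupWinProb μ p k (thresholdRule p) = p := by
    have hc : correctRate μ (fun _ => 0) = 0 := by simp [correctRate]
    have hw : wrongRate μ (fun _ => 0) = 0 := by simp [wrongRate]
    have h (n : ℕ) (f : ℕ → ℕ → ℝ) : trinomialMean 0 0 1 n f = f 0 0 := by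
      induction n with
      | zero => rfl
      | succ n ih => simp [trinomialMean, ih]
    rw [groupWinProb_congr (thresholdRule_top_ae hμ), groupWinProb, hc, hw, sub_zero, sub_zero, h]
    simp [winProb]
  -- By continuity, the odds of the threshold `t` can be chosen above the square root of those
  -- of `p`.
  have hev : ∀ᶠ t in nhds p, p * (1 - t) ^ 2 < (1 - p) * t ^ 2 := by
    refine ContinuousAt.eventually_lt (by fun_prop) (by fun_prop) ?_
    have : 0 < p * (1 - p) * (2 * p - 1) := by
      have : 0 < 2 * p - 1 := by linarith
      have : 0 < 1 - p := by linarith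
      positivity
    nlinarith
  obtain ⟨t, hteq, ht⟩ := ((hev.filter_mono nhdsWithin_le_nhds).and
    (Ico_mem_nhdsLT hp)).exists
  have hv := isVotingRule_thresholdRule p t
  set c := correctRate μ (thresholdRule t) with hc
  set w := wrongRate μ (thresholdRule t) with hw
  have hw0 : 0 < w := by
    have := thresholdRule_rates_pos ht hp1 hμ (a := 0) (b := 1)
      (fun q hq => by linarith [hq.2]) (fun q hq => by linarith [hq.2])
    rw [← hc, ← hw] at this
    linarith
  have hodds : t * w < (1 - t) * c := by
    have := thresholdRule_rates_pos ht hp1 hμ (a := 1 - t) (b := -t)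
      (fun q hq => by linarith [hq.1]) (fun q hq => by linarith [hq.1])
    rw [← hc, ← hw] at this
    linarith
  have ht0 : 0 < t := by linarith [ht.1]
  have ht1 : 0 < 1 - t := by linarith [ht.2]
  have hwc : w ≤ c := by
    have : (1 - t) * w ≤ (1 - t) * c := by nlinarith [ht.1]
    exact le_of_mul_le_mul_left this ht1
  refine ⟨t, ?_⟩
  rw [hnone, groupWinProb, ← hc, ← hw]
  refine lt_trinomialMean_winProb hw0 hwc (by linarith [hv.rates_add_le_one hp1 hμ]) hp1
    (by ring) ?_
  have h1 : (t * w) ^ 2 < ((1 - t) * c) ^ 2 := pow_lt_pow_left₀ hodds (by positivity) two_ne_zero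
  have h2 : (1 - p) * (t * w) ^ 2 < (1 - p) * ((1 - t) * c) ^ 2 :=
    mul_lt_mul_of_pos_left h1 (by linarith)
  have h3 : p * (1 - t) ^ 2 * w ^ 2 < (1 - p) * t ^ 2 * w ^ 2 :=
    mul_lt_mul_of_pos_right hteq (by positivity)
  have h4 : (1 - t) ^ 2 * (p * w ^ 2) < (1 - t) ^ 2 * ((1 - p) * c ^ 2) := by linarith
  exact lt_of_mul_lt_mul_left h4 (by positivity)

/-- An optimal threshold is strictly between the lowest precision and that of the expert, beats
the votes of everybody, and makes its own type indifferent between voting and delegation. -/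
theorem exists_interior_optimum (hp : 1 / 2 < p) (hp1 : p < 1)
    (hμ : μ.support = Set.Icc (1 / 2) p) (k : ℕ) :
    ∃ t ∈ Set.Ioo (1 / 2) p,
      (∀ v, IsVotingRule p v → groupWinProb μ p k v ≤ groupWinProb μ p k (thresholdRule t)) ∧
      groupWinProb μ p k (thresholdRule (1 / 2)) < groupWinProb μ p k (thresholdRule t) ∧
      ∃ c w d, correctRate μ (thresholdRule t) = c ∧ wrongRate μ (thresholdRule t) = w ∧
        1 - c - w = d ∧ 0 < w ∧ w ≤ c ∧ 0 < d ∧ (1 - p) * c ≤ p * w ∧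
        0 < distortionProb p c w d k ∧
        distortionProb p c w d k = (correctionProb p c w d k + distortionProb p c w d k) * t := by
  obtain ⟨t, ht, hmax⟩ := exists_optimal_thresholdRule hp hp1 hμ k
  have htop (s : ℝ) (hs : ∀ v, IsVotingRule p v →
      groupWinProb μ p k v ≤ groupWinProb μ p k (thresholdRule s)) : s ≠ p := by
    rintro rfl
    obtain ⟨u, hu⟩ := exists_groupWinProb_gt hp hp1 hμ k
    exact (hs _ (isVotingRule_thresholdRule s u)).not_gt hu
  have hrates (s : ℝ) (hs : s ∈ Set.Ico (1 / 2) p) : 0 < wrongRate μ (thresholdRule s) ∧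
      wrongRate μ (thresholdRule s) < correctRate μ (thresholdRule s) ∧
      (1 - p) * correctRate μ (thresholdRule s) < p * wrongRate μ (thresholdRule s) := by
    have h1 := thresholdRule_rates_pos hs hp1 hμ (a := 0) (b := 1)
      (fun q hq => by linarith [hq.2]) (fun q hq => by linarith [hq.2])
    have h2 := thresholdRule_rates_pos hs hp1 hμ (a := 1) (b := -1)
      (fun q hq => by linarith [hq.1, hs.1]) (fun q hq => by linarith [hq.1, hs.1])
    have h3 := thresholdRule_rates_pos hs hp1 hμ (a := -(1 - p)) (b := p)
      (fun q hq => by linarith [hq.2]) (fun q hq => by linarith [hq.2])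
    refine ⟨?_, ?_, ?_⟩ <;> linarith
  have hhalf (s : ℝ) (hs : ∀ v, IsVotingRule p v →
      groupWinProb μ p k v ≤ groupWinProb μ p k (thresholdRule s)) : s ≠ 1 / 2 := by
    rintro rfl
    have hmem : (1 / 2 : ℝ) ∈ Set.Ico (1 / 2) p := ⟨le_rfl, hp⟩
    obtain ⟨hw0, hwc, hcw⟩ := hrates _ hmem
    have hsum : 1 - correctRate μ (thresholdRule (1 / 2)) -
        wrongRate μ (thresholdRule (1 / 2)) = 0 := by
      have := (isVotingRule_thresholdRule p (1 / 2)).rates_add hp1 hμ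
      rw [integral_congr_ae (thresholdRule_half_ae hμ)] at this
      simp at this ⊢
      linarith
    have hβ := correctionProb_pos (k := k) hp1 (hw0.trans hwc) hw0 le_rfl
    have hα := distortionProb_pos (k := k) (by linarith : 0 < p) (hw0.trans hwc) hw0 le_rfl
    have h1 := distortionProb_le_of_optimal hp1 hμ hmem hs rfl rfl hsum (add_pos hβ hα)
    have h2 := correctionProb_lt_distortionProb (k := k) (hw0.trans hwc) hw0 hcw
    linarith
  have hmem : t ∈ Set.Ioo (1 / 2) p :=
    ⟨lt_of_le_of_ne ht.1 (hhalf t hmax).symm, lt_of_le_of_ne ht.2 (htop t hmax)⟩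
  obtain ⟨hw0, hwc, hcw⟩ := hrates t ⟨hmem.1.le, hmem.2⟩
  have hv := isVotingRule_thresholdRule p t
  have hd : 0 < 1 - correctRate μ (thresholdRule t) - wrongRate μ (thresholdRule t) := by
    have h : 0 < ∫ q, 1 - thresholdRule t q ∂μ := by
      refine integral_pos_of_Ioo hμ ((integrable_const _).sub (hv.integrable hμ))
        (fun q hq => sub_nonneg.2 (hv.mem_Icc q hq).2) hmem.1 le_rfl hmem.2.le fun q hq => ?_
      simp [thresholdRule, hq.2]
    rw [integral_sub (integrable_const _) (hv.integrable hμ), ← hv.rates_add hp1 hμ] at h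
    simp at h
    linarith
  have hβ := correctionProb_pos (k := k) hp1 (hw0.trans hwc) hw0 hd.le
  have hα := distortionProb_pos (k := k) (by linarith : 0 < p) (hw0.trans hwc) hw0 hd.le
  refine ⟨t, hmem, hmax, lt_of_le_of_ne (hmax _ (isVotingRule_thresholdRule p _)) fun heq => ?_,
    _, _, _, rfl, rfl, rfl, hw0, hwc.le, hd, hcw.le, hα, le_antisymm ?_ ?_⟩
  · exact hhalf (1 / 2) (fun v hv => (hmax v hv).trans heq.ge) rfl
  · exact distortionProb_le_of_optimal hp1 hμ ⟨hmem.1.le, hmem.2⟩ hmax rfl rfl rfl (add_pos hβ hα)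
  · exact le_distortionProb_of_optimal hp1 hμ ⟨hmem.1, hmem.2.le⟩ hmax rfl rfl rfl (add_pos hβ hα)

end Optimum

/-! ### Interim payoffs and dominated strategies -/

namespace Environment

section Interim

variable {N : ℕ} (G : Environment N)

theorem signalProb_self (q : ℝ) (s : Bool) : signalProb q s s = q := by simp [signalProb]

theorem signalProb_not (q : ℝ) (s : Bool) : signalProb q s (!s) = 1 - q := by simp [signalProb]

theorem sum_bool_eq {R : Type*} [AddCommMonoid R] (s : Bool) (f : Bool → R) :
    ∑ ω, f ω = f s + f (!s) := by
  cases s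
  · rw [Fintype.sum_bool, add_comm]; rfl
  · rw [Fintype.sum_bool]; rfl

theorem stateProb_eq (hprior : G.prior = 1 / 2) (ω : Bool) : G.stateProb ω = 1 / 2 := by
  rw [stateProb, hprior]
  split_ifs <;> norm_num

theorem interimEU_eq (hprior : G.prior = 1 / 2) (σ : Profile N) (i : Fin N) (q : ℝ) (s : Bool)
    (b : Action) :
    G.interimEU σ i q s b =
      q * G.correctGiven s (Function.update (G.actionProb σ s) i (play b)) +
      (1 - q) * G.correctGiven (!s) (Function.update (G.actionProb σ !s) i (play b)) := by
  rw [interimEU, sum_bool_eq s, sum_bool_eq s]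
  simp only [G.stateProb_eq hprior, signalProb_self, signalProb_not]
  rw [← mul_add, add_sub_cancel]
  ring

theorem IsStrategy.le_one {G : Environment N} {i : Fin N} {τ : Strategy} (hτ : G.IsStrategy i τ)
    {q : ℝ} (hq : q ∈ G.precisions i) (s : Bool) (a : Action) : τ q s a ≤ 1 := by
  rw [← hτ.sum_eq_one q hq s]
  exact Finset.single_le_sum (fun b _ => hτ.nonneg q hq s b) (Finset.mem_univ a)

/-- The lottery over actions, given the state, that a strategy of `i` amounts to. -/
noncomputable def inducedLottery (i : Fin N) (τ : Strategy) (ω : Bool) (a : Action) : ℝ :=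
  ∫ q, ∑ s, signalProb q s ω * τ q s a ∂(G.precisionLaw i)

theorem actionProb_update (σ : Profile N) (i : Fin N) (τ : Strategy) (ω : Bool) :
    G.actionProb (Function.update σ i τ) ω =
      Function.update (G.actionProb σ ω) i (G.inducedLottery i τ ω) := by
  ext j a
  by_cases hj : j = i
  · subst hj
    simp [actionProb, inducedLottery]
  · simp [actionProb, hj]

theorem isProbabilityMeasure_precisionLaw [IsProbabilityMeasure G.F] (i : Fin N) :
    IsProbabilityMeasure (G.precisionLaw i) := by
  rw [precisionLaw]
  split_ifs <;> infer_instance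

theorem ae_mem_precisions (hsupp : G.F.support = Set.Icc (1 / 2) G.p) (i : Fin N) :
    ∀ᵐ q ∂(G.precisionLaw i), q ∈ G.precisions i := by
  rw [precisionLaw, precisions]
  split_ifs
  · rw [ae_dirac_eq]
    exact Set.mem_singleton _
  · exact ae_mem_Icc hsupp

theorem precisions_subset (hp : 1 / 2 < G.p) (i : Fin N) :
    G.precisions i ⊆ Set.Icc (1 / 2) G.p := by
  rw [precisions]
  split_ifs
  · exact Set.singleton_subset_iff.2 ⟨hp.le, le_rfl⟩
  · exact subset_rfl

theorem measurable_signalProb (s ω : Bool) : Measurable fun q => signalProb q s ω := by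
  simp only [signalProb]
  split_ifs <;> fun_prop

variable {G}

theorem IsStrategy.integrable_signalProb_mul [IsProbabilityMeasure G.F] (hp : 1 / 2 < G.p)
    (hp1 : G.p < 1) (hsupp : G.F.support = Set.Icc (1 / 2) G.p) {i : Fin N} {τ : Strategy}
    (hτ : G.IsStrategy i τ) (s ω : Bool) (a : Action) :
    Integrable (fun q => signalProb q s ω * τ q s a) (G.precisionLaw i) := by
  have := G.isProbabilityMeasure_precisionLaw i
  refine Integrable.of_bound
    ((measurable_signalProb s ω).mul (hτ.measurable s a)).aestronglyMeasurable 1 ?_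
  filter_upwards [G.ae_mem_precisions hsupp i] with q hq
  have hq' := G.precisions_subset hp i hq
  have h0 : 0 ≤ signalProb q s ω ∧ signalProb q s ω ≤ 1 := by
    rw [signalProb]
    split_ifs <;> constructor <;> linarith [hq'.1, hq'.2]
  rw [Real.norm_of_nonneg (mul_nonneg h0.1 (hτ.nonneg q hq s a))]
  exact mul_le_one₀ h0.2 (hτ.nonneg q hq s a) (hτ.le_one hq s a)

theorem IsStrategy.integrable_interimEU [IsProbabilityMeasure G.F] (hp : 1 / 2 < G.p)
    (hp1 : G.p < 1) (hsupp : G.F.support = Set.Icc (1 / 2) G.p) (hprior : G.prior = 1 / 2)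
    {i : Fin N} {τ : Strategy} (hτ : G.IsStrategy i τ) (σ : Profile N) :
    Integrable (fun q => ∑ s, ∑ b, τ q s b * G.interimEU σ i q s b) (G.precisionLaw i) := by
  refine integrable_finsetSum _ fun s _ => integrable_finsetSum _ fun b _ => ?_
  have h (ω : Bool) := (hτ.integrable_signalProb_mul hp hp1 hsupp s ω b).mul_const
    (G.correctGiven ω (Function.update (G.actionProb σ ω) i (play b)))
  refine ((h s).add (h !s)).congr (ae_of_all _ fun q => ?_)
  simp only [Pi.add_apply, signalProb_self, signalProb_not]
  rw [G.interimEU_eq hprior]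
  ring

/-- Ex ante utility is half the integral of interim utilities, because either signal is received
with probability one half. -/
theorem IsStrategy.EU_update [IsProbabilityMeasure G.F] (hp : 1 / 2 < G.p)
    (hp1 : G.p < 1) (hsupp : G.F.support = Set.Icc (1 / 2) G.p) (hprior : G.prior = 1 / 2)
    {i : Fin N} {τ : Strategy} (hτ : G.IsStrategy i τ) (σ : Profile N) :
    G.EU (Function.update σ i τ) =
      1 / 2 * ∫ q, ∑ s, ∑ b, τ q s b * G.interimEU σ i q s b ∂(G.precisionLaw i) := by
  set U : Bool → Action → ℝ := fun ω b =>
    G.correctGiven ω (Function.update (G.actionProb σ ω) i (play b)) with hU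
  have hint := fun s ω a => hτ.integrable_signalProb_mul hp hp1 hsupp s ω a
  have h1 (ω : Bool) : G.correctGiven ω (G.actionProb (Function.update σ i τ) ω) =
      ∫ q, ∑ b, ∑ s, signalProb q s ω * τ q s b * U ω b ∂(G.precisionLaw i) := by
    rw [integral_finsetSum _ fun b _ => integrable_finsetSum _ fun s _ =>
      (hint s ω b).mul_const _, correctGiven, ← lotteryMean, lotteryMean_eq_sum _ _ i]
    refine Finset.sum_congr rfl fun b _ => ?_
    rw [actionProb_update, Function.update_self, Function.update_idem, inducedLottery,
      ← integral_mul_const]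
    congr 1
    ext q
    rw [Finset.sum_mul]
    rfl
  rw [EU]
  simp only [h1, G.stateProb_eq hprior]
  rw [← Finset.mul_sum, ← integral_finsetSum]
  · congr 2
    ext q
    simp only [G.interimEU_eq hprior, Fintype.sum_bool, ← Finset.sum_add_distrib, signalProb]
    refine Finset.sum_congr rfl fun b _ => ?_
    simp [hU]
    ring
  · exact fun ω _ => integrable_finsetSum _ fun b _ => integrable_finsetSum _ fun s _ =>
      (hint s ω b).mul_const _

/-- A strategy that is the only best response, up to a null set of precisions, to some profile is
not weakly dominated. -/
theorem not_weaklyDominated [IsProbabilityMeasure G.F] (hp : 1 / 2 < G.p)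
    (hp1 : G.p < 1) (hsupp : G.F.support = Set.Icc (1 / 2) G.p) (hprior : G.prior = 1 / 2)
    {i : Fin N} {σ : Profile N} (hσ : G.IsProfile σ)
    (h : ∀ᵐ q ∂(G.precisionLaw i), ∀ s, ∃ b, σ i q s = play b ∧ ∀ b' ≠ b,
      Feasible G.experts i b' → G.interimEU σ i q s b' < G.interimEU σ i q s b) :
    ¬ G.WeaklyDominated i (σ i) := by
  rintro ⟨τ, hτ, hle, σ', -, hlt⟩
  have hle := hle σ hσ
  rw [(hσ i).EU_update hp hp1 hsupp hprior, hτ.EU_update hp hp1 hsupp hprior] at hle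
  set f : Strategy → ℝ → ℝ := fun τ q => ∑ s, ∑ b, τ q s b * G.interimEU σ i q s b with hf
  have hfi : Integrable (f (σ i)) (G.precisionLaw i) :=
    (hσ i).integrable_interimEU hp hp1 hsupp hprior σ
  have hfτ : Integrable (f τ) (G.precisionLaw i) := hτ.integrable_interimEU hp hp1 hsupp hprior σ
  -- The loss from `τ`, term by term.
  have hloss : ∀ᵐ q ∂(G.precisionLaw i), ∀ s, ∃ b, σ i q s = play b ∧
      (∑ b', σ i q s b' * G.interimEU σ i q s b' - ∑ b', τ q s b' * G.interimEU σ i q s b' =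
        ∑ b', τ q s b' * (G.interimEU σ i q s b - G.interimEU σ i q s b')) ∧
      (∀ b', 0 ≤ τ q s b' * (G.interimEU σ i q s b - G.interimEU σ i q s b')) ∧
      ∀ b', b' ≠ b → τ q s b' * (G.interimEU σ i q s b - G.interimEU σ i q s b') = 0 →
        τ q s b' = 0 := by
    filter_upwards [h, G.ae_mem_precisions hsupp i] with q hq hqp s
    obtain ⟨b, hb, hbest⟩ := hq s
    refine ⟨b, hb, ?_, fun b' => ?_, fun b' hb' h0 => ?_⟩
    · simp only [mul_sub, Finset.sum_sub_distrib, ← Finset.sum_mul, hτ.sum_eq_one q hqp s, hb]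
      simp [play]
    · by_cases hbb : b' = b
      · simp [hbb]
      · by_cases hfe : Feasible G.experts i b'
        · exact mul_nonneg (hτ.nonneg q hqp s b') (sub_nonneg.2 (hbest b' hbb hfe).le)
        · simp [hτ.feasible q hqp s b' hfe]
    · by_cases hfe : Feasible G.experts i b'
      · exact (mul_eq_zero.1 h0).resolve_right (sub_pos.2 (hbest b' hb' hfe)).ne'
      · exact hτ.feasible q hqp s b' hfe
  have hnn : 0 ≤ᵐ[G.precisionLaw i] fun q => f (σ i) q - f τ q := by
    filter_upwards [hloss] with q hq
    simp only [hf, Pi.zero_apply]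
    rw [← Finset.sum_sub_distrib]
    refine Finset.sum_nonneg fun s _ => ?_
    obtain ⟨b, -, hsum, hnn, -⟩ := hq s
    rw [hsum]
    exact Finset.sum_nonneg fun b' _ => hnn b'
  have hzero : (fun q => f (σ i) q - f τ q) =ᵐ[G.precisionLaw i] 0 := by
    rw [← integral_eq_zero_iff_of_nonneg_ae hnn (hfi.sub hfτ)]
    refine le_antisymm ?_ (integral_nonneg_of_ae hnn)
    rw [integral_sub hfi hfτ]
    linarith
  have heq : ∀ᵐ q ∂(G.precisionLaw i), τ q = σ i q := by
    filter_upwards [hloss, hzero, G.ae_mem_precisions hsupp i] with q hq h0 hqp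
    simp only [hf, Pi.zero_apply] at h0
    rw [← Finset.sum_sub_distrib, Finset.sum_eq_zero_iff_of_nonneg fun s _ => by
      obtain ⟨b, -, hsum, hnn, -⟩ := hq s
      rw [hsum]
      exact Finset.sum_nonneg fun b' _ => hnn b'] at h0
    funext s
    have h0 := h0 s (Finset.mem_univ s)
    obtain ⟨b, hb, hsum, hnn, hz⟩ := hq s
    rw [hsum, Finset.sum_eq_zero_iff_of_nonneg fun b' _ => hnn b'] at h0
    have hz' (b') (hb' : b' ≠ b) : τ q s b' = 0 := hz b' hb' (h0 b' (Finset.mem_univ b'))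
    have h1 := hτ.sum_eq_one q hqp s
    rw [Finset.sum_eq_single b (fun b' _ hb' => hz' b' hb') (by simp)] at h1
    rw [hb]
    funext b'
    by_cases hbb : b' = b
    · simp [play, hbb, h1]
    · simp [play, hbb, hz' b' hbb]
  have hlot (ω : Bool) : G.inducedLottery i τ ω = G.inducedLottery i (σ i) ω := by
    funext a
    exact integral_congr_ae (heq.mono fun q hq => by simp only [hq])
  refine hlt.ne ?_
  simp only [EU, actionProb_update, hlot]

end Interim

/-! ### Profiles in which only non-experts delegate, and only to the expert -/

section OneExpert

variable {k : ℕ} {e : Fin (2 * k + 3)} {G : Environment (2 * k + 3)} {σ : Profile (2 * k + 3)}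

theorem precisions_expert (hE : G.experts = {e}) : G.precisions e = {G.p} := by
  simp [precisions, hE]

theorem precisions_nonExpert (hE : G.experts = {e}) {j : Fin (2 * k + 3)} (hj : j ≠ e) :
    G.precisions j = Set.Icc (1 / 2) G.p := by
  simp [precisions, hE, hj]

theorem precisionLaw_nonExpert (hE : G.experts = {e}) {j : Fin (2 * k + 3)} (hj : j ≠ e) :
    G.precisionLaw j = G.F := by
  simp [precisionLaw, hE, hj]

theorem exists_votingRule (hE : G.experts = {e}) (hσ : G.IsProfile σ) (hsym : G.SemiSymmetric σ) :
    ∃ v, IsVotingRule G.p v ∧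
      ∀ j ≠ e, ∀ q ∈ Set.Icc (1 / 2) G.p, ∀ s, σ j q s (.vote s) = v q := by
  obtain ⟨i, hi⟩ : ∃ i, i ≠ e := exists_ne e
  have hpi := precisions_nonExpert hE hi
  refine ⟨fun q => σ i q true (.vote true), ⟨(hσ i).measurable _ _, fun q hq => ?_⟩,
    fun j hj q hq s => ?_⟩
  · rw [← hpi] at hq
    exact ⟨(hσ i).nonneg q hq _ _, (hσ i).le_one hq _ _⟩
  · rw [← hpi] at hq
    rw [← hsym.1 i j (by simp [hE, hi, hj]) q hq]
    cases s
    · exact hsym.2 i q hq true (.vote true)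
    · rfl

theorem hasWeights_expert (hE : G.experts = {e}) (hσ : G.IsProfile σ) (hsin : G.Sincere σ)
    (honly : G.OnlyToExperts σ) (ω : Bool) :
    HasWeights ω G.p (1 - G.p) 0 (G.actionProb σ ω e) := by
  have hmem : G.p ∈ G.precisions e := by simp [precisions_expert hE]
  have hone (s : Bool) : σ e G.p s (.vote s) = 1 := by
    have h := (hσ e).sum_eq_one G.p hmem s
    have h2 := honly.1 e (by simp [hE]) G.p hmem s
    rw [sum_action s, hsin e G.p hmem s, h2.1, h2.2] at h
    linarith
  have hvote (s : Bool) : σ e G.p (!s) (.vote s) = 0 := by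
    simpa using hsin e G.p hmem (!s)
  have hact (a : Action) : G.actionProb σ ω e a =
      G.p * σ e G.p ω a + (1 - G.p) * σ e G.p (!ω) a := by
    have hlaw : G.precisionLaw e = Measure.dirac G.p := by simp [precisionLaw, hE]
    rw [actionProb, hlaw, integral_dirac, sum_bool_eq ω, signalProb_self]
    simp [signalProb]
  have h1 (s : Bool) := honly.1 e (by simp [hE]) G.p hmem s
  constructor <;> rw [hact]
  · rw [hone, hvote]; ring
  · rw [hone, hsin e G.p hmem]; ring
  · rw [(h1 _).1, (h1 _).1]; ring
  · rw [(h1 _).2, (h1 _).2]; ring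

theorem hasWeights_nonExpert [IsProbabilityMeasure G.F] (hE : G.experts = {e}) (hp1 : G.p < 1)
    (hsupp : G.F.support = Set.Icc (1 / 2) G.p) (hσ : G.IsProfile σ) (hsin : G.Sincere σ)
    (honly : G.OnlyToExperts σ) {v : ℝ → ℝ} (hv : IsVotingRule G.p v)
    (hσv : ∀ j ≠ e, ∀ q ∈ Set.Icc (1 / 2) G.p, ∀ s, σ j q s (.vote s) = v q)
    {j : Fin (2 * k + 3)} (hj : j ≠ e) (ω : Bool) :
    HasWeights ω (correctRate G.F v) (wrongRate G.F v) (1 - correctRate G.F v - wrongRate G.F v)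
      (G.actionProb σ ω j) := by
  have hpj := precisions_nonExpert hE hj
  have hact (a : Action) (f : ℝ → ℝ) (h : ∀ q ∈ Set.Icc (1 / 2) G.p,
      q * σ j q ω a + (1 - q) * σ j q (!ω) a = f q) : G.actionProb σ ω j a = ∫ q, f q ∂G.F := by
    rw [actionProb, precisionLaw_nonExpert hE hj]
    refine integral_congr_ae ((ae_mem_Icc hsupp).mono fun q hq => ?_)
    simp only [sum_bool_eq ω, signalProb_self, ← h q hq]
    simp [signalProb]
  have hagainst (q) (hq : q ∈ Set.Icc (1 / 2) G.p) (s : Bool) : σ j q s (.vote !s) = 0 :=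
    hsin j q (hpj ▸ hq) s
  have hnon (q) (hq : q ∈ Set.Icc (1 / 2) G.p) (s : Bool) : σ j q s .toNonExpert = 0 :=
    honly.2 j (by simp [hE, hj]) q (hpj ▸ hq) s
  have hto (q) (hq : q ∈ Set.Icc (1 / 2) G.p) (s : Bool) : σ j q s .toExpert = 1 - v q := by
    have h := (hσ j).sum_eq_one q (hpj ▸ hq) s
    rw [sum_action s, hσv j hj q hq, hagainst q hq, hnon q hq] at h
    linarith
  refine ⟨hact _ _ fun q hq => ?_, hact _ _ fun q hq => ?_, ?_, ?_⟩
  · have := hagainst q hq (!ω)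
    rw [Bool.not_not] at this
    rw [hσv j hj q hq, this]
    ring
  · rw [hagainst q hq, hσv j hj q hq]
    ring
  · rw [hact _ (fun q => 1 - v q) fun q hq => by rw [hto q hq, hto q hq]; ring,
      integral_sub (integrable_const _) (hv.integrable hsupp), ← hv.rates_add hp1 hsupp]
    simp
    ring
  · rw [hact _ (fun _ => 0) fun q hq => by rw [hnon q hq, hnon q hq]; ring]
    simp

theorem EU_eq_groupWinProb [IsProbabilityMeasure G.F] (hE : G.experts = {e}) (hp1 : G.p < 1)
    (hsupp : G.F.support = Set.Icc (1 / 2) G.p) (hprior : G.prior = 1 / 2)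
    (hσ : G.IsProfile σ) (hsin : G.Sincere σ) (honly : G.OnlyToExperts σ) {v : ℝ → ℝ}
    (hv : IsVotingRule G.p v)
    (hσv : ∀ j ≠ e, ∀ q ∈ Set.Icc (1 / 2) G.p, ∀ s, σ j q s (.vote s) = v q) :
    G.EU σ = groupWinProb G.F G.p k v := by
  have h (ω : Bool) : G.correctGiven ω (G.actionProb σ ω) = groupWinProb G.F G.p k v :=
    correctGiven_eq G hE (hasWeights_expert hE hσ hsin honly ω) fun j hj =>
      hasWeights_nonExpert hE hp1 hsupp hσ hsin honly hv hσv hj ω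
  simp only [EU, h, G.stateProb_eq hprior, Fintype.sum_bool]
  ring

theorem feasible_nonExpert (hE : G.experts = {e}) {i : Fin (2 * k + 3)} (hi : i ≠ e)
    (a : Action) : Feasible G.experts i a := by
  rw [Feasible, hE]
  rcases a with d | _ | _
  · simp [targets]
  · simp [targets_toExpert hi]
  · rw [targets, ← Finset.card_pos, card_compl_erase hi]
    omega

theorem isProfile_thresholdProfile (hE : G.experts = {e}) (t : ℝ) :
    G.IsProfile (G.thresholdProfile t) := by
  intro i
  have hplay (b : Action) : ∑ a, play b a = 1 := by simp [play]
  refine ⟨fun s a => ?_, fun q _ s a => ?_, fun q _ s => ?_, fun q _ s a ha => ?_⟩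
  · by_cases hi : i ∈ G.experts
    · simp [thresholdProfile, hi]
    · have : (fun q => G.thresholdProfile t i q s a) =
          fun q => if q < t then play .toExpert a else play (.vote s) a := by
        funext q
        simp only [thresholdProfile, hi, not_false_eq_true, true_and]
        split_ifs <;> rfl
      rw [this]
      exact Measurable.ite measurableSet_Iio measurable_const measurable_const
  · simp only [thresholdProfile]
    split_ifs <;> simp only [play] <;> split_ifs <;> norm_num
  · simp only [thresholdProfile]
    split_ifs <;> exact hplay _
  · have hne (b : Action) (hb : Feasible G.experts i b) : play b a = 0 := by
      rw [play, if_neg]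
      rintro rfl
      exact ha hb
    simp only [thresholdProfile]
    split_ifs with h
    · refine hne _ (feasible_nonExpert hE (fun hie => h.1 ?_) _)
      simp [hE, hie]
    · exact hne _ (by simp [Feasible, targets])

theorem semiSymmetric_thresholdProfile (G : Environment (2 * k + 3)) (t : ℝ) :
    G.SemiSymmetric (G.thresholdProfile t) := by
  refine ⟨fun i j hij q _ => funext fun s => by simp only [thresholdProfile, hij],
    fun i q _ s a => ?_⟩
  simp only [thresholdProfile]
  split_ifs
  · cases a <;> simp [play, Action.flip]
  · cases a <;> simp [play, Action.flip]

theorem sincere_thresholdProfile (G : Environment (2 * k + 3)) (t : ℝ) :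
    G.Sincere (G.thresholdProfile t) := by
  intro i q _ s
  simp only [thresholdProfile]
  split_ifs <;> simp [play]

theorem onlyToExperts_thresholdProfile (G : Environment (2 * k + 3)) (t : ℝ) :
    G.OnlyToExperts (G.thresholdProfile t) := by
  refine ⟨fun i hi q _ s => by simp [thresholdProfile, hi, play], fun i hi q _ s => ?_⟩
  simp only [thresholdProfile]
  split_ifs <;> simp [play]

theorem thresholdProfile_vote (hE : G.experts = {e}) (t : ℝ) {j : Fin (2 * k + 3)} (hj : j ≠ e)
    (q : ℝ) (s : Bool) : G.thresholdProfile t j q s (.vote s) = thresholdRule t q := by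
  have : j ∉ G.experts := by simp [hE, hj]
  simp only [thresholdProfile, this, not_false_eq_true, true_and, thresholdRule]
  split_ifs <;> simp [play]

theorem EU_thresholdProfile [IsProbabilityMeasure G.F] (hE : G.experts = {e}) (hp1 : G.p < 1)
    (hsupp : G.F.support = Set.Icc (1 / 2) G.p) (hprior : G.prior = 1 / 2) (t : ℝ) :
    G.EU (G.thresholdProfile t) = groupWinProb G.F G.p k (thresholdRule t) :=
  EU_eq_groupWinProb hE hp1 hsupp hprior (isProfile_thresholdProfile hE t)
    (sincere_thresholdProfile G t) (onlyToExperts_thresholdProfile G t)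
    (isVotingRule_thresholdRule G.p t) fun _ hj q _ s => thresholdProfile_vote hE t hj q s

/-- Everybody votes if the threshold is the lowest precision. -/
theorem EU_majorityVoting [IsProbabilityMeasure G.F]
    (hsupp : G.F.support = Set.Icc (1 / 2) G.p) :
    G.EU majorityVoting = G.EU (G.thresholdProfile (1 / 2)) := by
  have h (ω : Bool) :
      G.actionProb majorityVoting ω = G.actionProb (G.thresholdProfile (1 / 2)) ω := by
    funext i a
    rw [actionProb, actionProb]
    by_cases hi : i ∈ G.experts
    · simp [thresholdProfile, majorityVoting, hi]
    · refine integral_congr_ae ?_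
      rw [precisionLaw, if_neg hi]
      filter_upwards [ae_mem_Icc hsupp] with q hq
      simp only [thresholdProfile, majorityVoting, hq.1.not_gt, and_false, if_false]
  simp only [EU, h]

end OneExpert

/-! ### The threshold profile is an equilibrium -/

section Equilibrium

variable {k : ℕ} {e : Fin (2 * k + 3)} {G : Environment (2 * k + 3)} {t c w d : ℝ}

theorem hasWeights_thresholdProfile [IsProbabilityMeasure G.F] (hE : G.experts = {e})
    (hp1 : G.p < 1) (hsupp : G.F.support = Set.Icc (1 / 2) G.p)
    (hc : correctRate G.F (thresholdRule t) = c) (hw : wrongRate G.F (thresholdRule t) = w)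
    (hd : 1 - c - w = d) {j : Fin (2 * k + 3)} (hj : j ≠ e) (ω : Bool) :
    HasWeights ω c w d (G.actionProb (G.thresholdProfile t) ω j) := by
  subst hc hw hd
  exact hasWeights_nonExpert hE hp1 hsupp (isProfile_thresholdProfile hE t)
    (sincere_thresholdProfile G t) (onlyToExperts_thresholdProfile G t)
    (isVotingRule_thresholdRule G.p t) (fun _ hj q _ s => thresholdProfile_vote hE t hj q s) hj ω

theorem expert_strictly_prefers_vote [IsProbabilityMeasure G.F] (hE : G.experts = {e})
    (hprior : G.prior = 1 / 2) (hp : 1 / 2 < G.p) (hp1 : G.p < 1)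
    (hsupp : G.F.support = Set.Icc (1 / 2) G.p)
    (hc : correctRate G.F (thresholdRule t) = c) (hw : wrongRate G.F (thresholdRule t) = w)
    (hd : 1 - c - w = d) (hw0 : 0 < w) (hwc : w ≤ c) (hd0 : 0 < d)
    (hcw : (1 - G.p) * c ≤ G.p * w) (s : Bool) {b : Action} (hb : b ≠ .vote s)
    (hfeas : Feasible G.experts e b) :
    G.interimEU (G.thresholdProfile t) e G.p s b <
      G.interimEU (G.thresholdProfile t) e G.p s (.vote s) := by
  have hρ (ω : Bool) : ∀ j ≠ e, HasWeights ω c w d (G.actionProb (G.thresholdProfile t) ω j) :=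
    fun j hj => hasWeights_thresholdProfile hE hp1 hsupp hc hw hd hj ω
  have hvote : G.interimEU (G.thresholdProfile t) e G.p s (.vote s) =
      trinomialMean c w d (2 * k + 2) (winProb G.p (k + 1)) := by
    rw [G.interimEU_eq hprior, correctGiven_expert_vote G hE s (hρ s),
      correctGiven_expert_vote G hE s (hρ !s), ← trinomialMean_mul_left, ← trinomialMean_mul_left,
      ← trinomialMean_add]
    congr 1
    ext x y
    simp [winProb]
  rw [hvote]
  rcases b with s' | _ | _
  · obtain rfl : s' = !s := Bool.eq_not.2 fun h => hb (h ▸ rfl)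
    have : G.interimEU (G.thresholdProfile t) e G.p s (.vote !s) =
        trinomialMean c w d (2 * k + 2) (winProb (1 - G.p) (k + 1)) := by
      rw [G.interimEU_eq hprior, correctGiven_expert_vote G hE (!s) (hρ s),
        correctGiven_expert_vote G hE (!s) (hρ !s), ← trinomialMean_mul_left,
        ← trinomialMean_mul_left, ← trinomialMean_add]
      congr 1
      ext x y
      simp [winProb]
      ring
    rw [this]
    exact trinomialMean_expert_vote_not_lt (hw0.le.trans hwc) hw0.le hd0 hp
  · simp [Feasible, targets, hE] at hfeas
  · rw [G.interimEU_eq hprior, correctGiven_expert_delegates G hE (hρ s),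
      correctGiven_expert_delegates G hE (hρ !s), ← add_mul, add_sub_cancel, one_mul]
    exact trinomialMean_expert_delegates_lt hw0.le hwc hd0 hp hcw

/-- The interim payoffs of a non-expert, relative to those from delegation to the expert. -/
theorem interimEU_nonExpert [IsProbabilityMeasure G.F] (hE : G.experts = {e})
    (hprior : G.prior = 1 / 2) (hp1 : G.p < 1)
    (hsupp : G.F.support = Set.Icc (1 / 2) G.p)
    (hc : correctRate G.F (thresholdRule t) = c) (hw : wrongRate G.F (thresholdRule t) = w)
    (hd : 1 - c - w = d) {i : Fin (2 * k + 3)} (hi : i ≠ e) (q : ℝ) (s : Bool) :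
    G.interimEU (G.thresholdProfile t) i q s (.vote s) =
        G.interimEU (G.thresholdProfile t) i q s .toExpert +
          (q * correctionProb G.p c w d k - (1 - q) * distortionProb G.p c w d k) ∧
      G.interimEU (G.thresholdProfile t) i q s (.vote !s) =
        G.interimEU (G.thresholdProfile t) i q s .toExpert +
          ((1 - q) * correctionProb G.p c w d k - q * distortionProb G.p c w d k) ∧
      G.interimEU (G.thresholdProfile t) i q s .toNonExpert =
        G.interimEU (G.thresholdProfile t) i q s .toExpert + (k + 1) / (2 * k + 1) *
          (correctionProb G.p c w d k - distortionProb G.p c w d k) := by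
  have he (ω : Bool) : HasWeights ω G.p (1 - G.p) 0 (G.actionProb (G.thresholdProfile t) ω e) :=
    hasWeights_expert hE (isProfile_thresholdProfile hE t) (sincere_thresholdProfile G t)
      (onlyToExperts_thresholdProfile G t) ω
  have hρ (ω : Bool) : ∀ j ≠ e, j ≠ i →
      HasWeights ω c w d (G.actionProb (G.thresholdProfile t) ω j) :=
    fun j hj _ => hasWeights_thresholdProfile hE hp1 hsupp hc hw hd hj ω
  have hright (ω : Bool) := correctGiven_nonExpert G hE hi (b := .vote ω) (by simp) (he ω) (hρ ω)
  have hwrong (ω : Bool) :=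
    correctGiven_nonExpert G hE hi (b := .vote !ω) (by simp) (he ω) (hρ ω)
  have hto (ω : Bool) := correctGiven_nonExpert G hE hi (b := .toExpert) (by simp) (he ω) (hρ ω)
  have hnon (ω : Bool) := correctGiven_nonExpert_delegates G hE hi (he ω) (hρ ω)
  simp only [Action.vote.injEq, if_true, reduceCtorEq, if_false, add_zero, Bool.eq_not_self,
    Bool.not_eq_self, trinomialMean_winProb_succ_left, trinomialMean_winProb_succ_right,
    trinomialMean_nonExpert_delegates] at hright hwrong hto hnon
  have hwrong' := hwrong (!s)
  rw [Bool.not_not] at hwrong'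
  simp only [G.interimEU_eq hprior, hright, hwrong, hwrong', hto, hnon]
  refine ⟨?_, ?_, ?_⟩ <;> ring

/-- The best action of a non-expert is unique except at the threshold. -/
theorem nonExpert_bestResponse [IsProbabilityMeasure G.F] (hE : G.experts = {e})
    (hprior : G.prior = 1 / 2) (hp1 : G.p < 1) (hsupp : G.F.support = Set.Icc (1 / 2) G.p)
    (hc : correctRate G.F (thresholdRule t) = c) (hw : wrongRate G.F (thresholdRule t) = w)
    (hd : 1 - c - w = d) (ht : 1 / 2 < t) (hα : 0 < distortionProb G.p c w d k)
    (hfoc : distortionProb G.p c w d k =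
      (correctionProb G.p c w d k + distortionProb G.p c w d k) * t)
    {i : Fin (2 * k + 3)} (hi : i ≠ e) {q : ℝ} (hq : q ∈ Set.Icc (1 / 2) G.p) (s : Bool) :
    ∃ b, G.thresholdProfile t i q s = play b ∧
      (∀ b', G.interimEU (G.thresholdProfile t) i q s b' ≤
        G.interimEU (G.thresholdProfile t) i q s b) ∧
      (q ≠ t → ∀ b' ≠ b, G.interimEU (G.thresholdProfile t) i q s b' <
        G.interimEU (G.thresholdProfile t) i q s b) := by
  obtain ⟨h1, h2, h3⟩ := interimEU_nonExpert hE hprior hp1 hsupp hc hw hd hi q s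
  set β := correctionProb G.p c w d k
  set α := distortionProb G.p c w d k
  set u := G.interimEU (G.thresholdProfile t) i q s
  have hsum : 0 < β + α := pos_of_mul_pos_left (hfoc ▸ hα) (by linarith)
  have hαβ : β < α := by
    by_contra! h
    have := mul_lt_mul_of_pos_left ht hsum
    linarith
  have hvote (r : ℝ) : r * β - (1 - r) * α = (β + α) * (r - t) := by
    linear_combination -hfoc
  have hwrong : (1 - q) * β - q * α < 0 := by nlinarith [hq.1]
  have hnon : (k + 1 : ℝ) / (2 * k + 1) * (β - α) < 0 :=
    mul_neg_of_pos_of_neg (by positivity) (by linarith)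
  rw [hvote] at h1
  have hcases (P : Action → Prop) (hv : P (.vote s)) (hv' : P (.vote !s)) (he : P .toExpert)
      (hn : P .toNonExpert) (b : Action) : P b := by
    rcases b with s' | _ | _
    · by_cases hs : s' = s
      · exact hs ▸ hv
      · obtain rfl : s' = !s := Bool.eq_not.2 hs
        exact hv'
    · exact he
    · exact hn
  have hi' : i ∉ G.experts := by simp [hE, hi]
  by_cases hqt : q < t
  · have hneg : (β + α) * (q - t) < 0 := mul_neg_of_pos_of_neg (by linarith) (by linarith)
    refine ⟨.toExpert, by rw [thresholdProfile, if_pos ⟨hi', hqt⟩],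
      hcases _ ?_ ?_ ?_ ?_, fun _ => hcases _ ?_ ?_ ?_ ?_⟩
    · linarith
    · linarith
    · exact le_rfl
    · linarith
    · exact fun _ => by linarith
    · exact fun _ => by linarith
    · exact fun h => absurd rfl h
    · exact fun _ => by linarith
  · have hpos : 0 ≤ (β + α) * (q - t) := mul_nonneg (by linarith) (by linarith)
    refine ⟨.vote s, by rw [thresholdProfile, if_neg fun h => hqt h.2],
      hcases _ ?_ ?_ ?_ ?_, fun hne => hcases _ ?_ ?_ ?_ ?_⟩
    · exact le_rfl
    · linarith
    · linarith
    · linarith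
    · exact fun h => absurd rfl h
    · exact fun _ => by linarith
    · have hlt : t < q := lt_of_le_of_ne (not_lt.1 hqt) hne.symm
      have : 0 < (β + α) * (q - t) := mul_pos (by linarith) (by linarith)
      exact fun _ => by linarith
    · exact fun _ => by linarith

theorem isEquilibrium_thresholdProfile [IsProbabilityMeasure G.F] [NullSingletonClass G.F]
    (hE : G.experts = {e}) (hprior : G.prior = 1 / 2) (hp : 1 / 2 < G.p) (hp1 : G.p < 1)
    (hsupp : G.F.support = Set.Icc (1 / 2) G.p)
    (hc : correctRate G.F (thresholdRule t) = c) (hw : wrongRate G.F (thresholdRule t) = w)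
    (hd : 1 - c - w = d) (hw0 : 0 < w) (hwc : w ≤ c) (hd0 : 0 < d)
    (hcw : (1 - G.p) * c ≤ G.p * w) (ht : 1 / 2 < t) (hα : 0 < distortionProb G.p c w d k)
    (hfoc : distortionProb G.p c w d k =
      (correctionProb G.p c w d k + distortionProb G.p c w d k) * t) :
    G.IsEquilibrium (G.thresholdProfile t) := by
  have hprof := isProfile_thresholdProfile hE t
  have hplay {b a : Action} (h : 0 < play b a) : a = b := by
    by_contra hne
    simp [play, hne] at h
  have hexpert (q : ℝ) (s : Bool) : G.thresholdProfile t e q s = play (.vote s) := by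
    simp [thresholdProfile, hE]
  refine ⟨hprof, semiSymmetric_thresholdProfile G t, sincere_thresholdProfile G t,
    fun i q hq s a ha b hb => ?_, fun i => not_weaklyDominated hp hp1 hsupp hprior hprof ?_⟩
  · by_cases hi : i = e
    · subst hi
      obtain rfl : q = G.p := by simpa [precisions_expert hE] using hq
      rw [hexpert] at ha
      obtain rfl := hplay ha
      by_cases hbs : b = .vote s
      · rw [hbs]
      · exact (expert_strictly_prefers_vote hE hprior hp hp1 hsupp hc hw hd hw0 hwc hd0 hcw s hbs
          hb).le
    · rw [precisions_nonExpert hE hi] at hq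
      obtain ⟨b₀, hb₀, hle, -⟩ :=
        nonExpert_bestResponse hE hprior hp1 hsupp hc hw hd ht hα hfoc hi hq s
      rw [hb₀] at ha
      obtain rfl := hplay ha
      exact hle b
  · by_cases hi : i = e
    · subst hi
      filter_upwards [G.ae_mem_precisions hsupp i] with q hq s
      obtain rfl : q = G.p := by simpa [precisions_expert hE] using hq
      exact ⟨.vote s, hexpert _ s, fun b hb hfeas => expert_strictly_prefers_vote hE hprior hp hp1
        hsupp hc hw hd hw0 hwc hd0 hcw s hb hfeas⟩
    · have hne : ∀ᵐ q ∂(G.precisionLaw i), q ≠ t := by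
        rw [precisionLaw_nonExpert hE hi]
        simp [ae_iff, measure_singleton]
      filter_upwards [G.ae_mem_precisions hsupp i, hne] with q hq hqt s
      rw [precisions_nonExpert hE hi] at hq
      obtain ⟨b₀, hb₀, -, hlt⟩ :=
        nonExpert_bestResponse hE hprior hp1 hsupp hc hw hd ht hα hfoc hi hq s
      exact ⟨b₀, hb₀, fun b hb _ => hlt hqt b hb⟩

end Equilibrium

end Environment

end LiquidDemocracy

open LiquidDemocracy LiquidDemocracy.Environment in
theorem proposition1 (N : ℕ) (hN : Odd N) (hN3 : 3 ≤ N)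
    (G : LiquidDemocracy.Environment N)
    (hK : G.experts.card = 1)
    (hprior : G.prior = 1 / 2)
    (hp : 1 / 2 < G.p) (hp1 : G.p < 1)
    (hF : MeasureTheory.IsProbabilityMeasure G.F)
    (hFcont : Continuous (ProbabilityTheory.cdf G.F))
    (hFsupp : G.F.support = Set.Icc (1 / 2) G.p) :
    ∃ t ∈ Set.Ioo (1 / 2) G.p,
      G.IsEquilibrium (G.thresholdProfile t) ∧
      G.EU LiquidDemocracy.Environment.majorityVoting < G.EU (G.thresholdProfile t) ∧
      ∀ σ, G.IsProfile σ → G.SemiSymmetric σ → G.Sincere σ → G.OnlyToExperts σ →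
        G.EU σ ≤ G.EU (G.thresholdProfile t) := by
  obtain ⟨k, rfl⟩ : ∃ k, N = 2 * k + 3 := by
    obtain ⟨m, rfl⟩ := hN
    exact ⟨m - 1, by omega⟩
  obtain ⟨e, hE⟩ := Finset.card_eq_one.1 hK
  have := nullSingletonClass_of_continuous_cdf hFcont
  obtain ⟨t, ht, hmax, hmaj, c, w, d, hc, hw, hd, hw0, hwc, hd0, hcw, hα, hfoc⟩ :=
    exists_interior_optimum hp hp1 hFsupp k
  refine ⟨t, ht, isEquilibrium_thresholdProfile hE hprior hp hp1 hFsupp hc hw hd hw0 hwc hd0 hcw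
    ht.1 hα hfoc, ?_, fun σ hσ hsym hsin honly => ?_⟩
  · rwa [EU_majorityVoting hFsupp, EU_thresholdProfile hE hp1 hFsupp hprior,
      EU_thresholdProfile hE hp1 hFsupp hprior]
  · obtain ⟨v, hv, hσv⟩ := exists_votingRule hE hσ hsym
    rw [EU_eq_groupWinProb hE hp1 hFsupp hprior hσ hsin honly hv hσv,
      EU_thresholdProfile hE hp1 hFsupp hprior]
    exact hmax v hv
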